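/- **Proposition 1.7.** There is a universal constant $C>0$ such that the following holds for every integer $n\ge 2$, with $N=n^2$. Let $\mathbf S^2_N\subset\mathbf R^3$ be the sphere centered at the origin with surface area $N$. Let $X_1,\dots,X_N,Y_1,\dots,Y_N$ be independent random points, each uniformly distributed on $\mathbf S^2_N$ with respect to surface area, and let $A_1,\dots,A_n,B_1,\dots,B_n$ be independent random points, each uniformly distributed on the square $[0,\sqrt n]^2\subset\mathbf R^2$. Then $$\frac1n\,\mathbf E\min_{\sigma\in S_n}\sum_{i=1}^n|A_i-B_{\sigma(i)}|\;\le\; C+\frac{C}{N}\,\mathbf E\min_{\tau\in S_N}\sum_{j=1}^N|X_j-Y_{\tau(j)}|,$$ where $|\cdot|$ is the Euclidean distance (in $\mathbf R^2$ and in $\mathbf R^3$, respectively) and $S_k$ is the set of permutations of $\{1,\dots,k\}$. That is, the expected average distance in a minimal matching in the square is at most $C$ plus $C$ times the expected average distance in a minimal matching on the sphere. -/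

import Mathlib

open MeasureTheory ProbabilityTheory

/-- The cost of a minimal matching of the points `a₁, …, a_n` to the points `b₁, …, b_n`: the minimum,
over all bijections, of the sum of the distances between matched points. -/
noncomputable def minMatchingCost {E : Type*} [PseudoMetricSpace E] {n : ℕ} (a b : Fin n → E) : ℝ :=
  Finset.univ.inf' Finset.univ_nonempty
    fun σ : Equiv.Perm (Fin n) => ∑ i, dist (a i) (b (σ i))

/-- The radius of the sphere in `ℝ³` with surface area `N`, so that `4 π r ^ 2 = N`. -/
noncomputable def sphereRadius (N : ℕ) : ℝ := √(N / (4 * Real.pi))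

/-- The sphere `S²_N` in `ℝ³`, centered at the origin, with surface area `N`. -/
def sphereOfArea (N : ℕ) : Set (EuclideanSpace ℝ (Fin 3)) :=
  Metric.sphere 0 (sphereRadius N)

/-- The surface area measure of `S²_N`, as a measure on `ℝ³`: the surface measure of the unit sphere,
moved by the dilation `u ↦ r u` and multiplied by `r ^ 2`. -/
noncomputable def sphereAreaMeasure (N : ℕ) : Measure (EuclideanSpace ℝ (Fin 3)) :=
  ENNReal.ofReal (sphereRadius N ^ 2) •
    ((volume : Measure (EuclideanSpace ℝ (Fin 3))).toSphere.map
      fun u : Metric.sphere (0 : EuclideanSpace ℝ (Fin 3)) 1 =>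
        sphereRadius N • (u : EuclideanSpace ℝ (Fin 3)))

/-- The total mass of the surface area measure of `S²_N` is carried by `S²_N` and equals `N`. -/
theorem sphereAreaMeasure_sphereOfArea (N : ℕ) :
    sphereAreaMeasure N (sphereOfArea N) = N ∧ sphereAreaMeasure N (sphereOfArea N)ᶜ = 0 := by
  have hm : Measurable fun u : Metric.sphere (0 : EuclideanSpace ℝ (Fin 3)) 1 =>
      sphereRadius N • (u : EuclideanSpace ℝ (Fin 3)) := by fun_prop
  have hs : MeasurableSet (sphereOfArea N) := Metric.isClosed_sphere.measurableSet
  have hr : 0 ≤ sphereRadius N := Real.sqrt_nonneg _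
  have hpre : (fun u : Metric.sphere (0 : EuclideanSpace ℝ (Fin 3)) 1 =>
      sphereRadius N • (u : EuclideanSpace ℝ (Fin 3))) ⁻¹' (sphereOfArea N) = Set.univ := by
    ext u
    simp [sphereOfArea, norm_smul, abs_of_nonneg hr]
  constructor
  · rw [sphereAreaMeasure, Measure.smul_apply, Measure.map_apply hm hs, hpre,
      Measure.toSphere_apply_univ, EuclideanSpace.volume_ball_fin_three, sphereRadius,
      Real.sq_sqrt (by positivity)]
    simp only [finrank_euclideanSpace, Fintype.card_fin, smul_eq_mul]
    rw [← ENNReal.ofReal_natCast 3, ← ENNReal.ofReal_pow (by norm_num),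
      ← ENNReal.ofReal_mul (by positivity), ← ENNReal.ofReal_mul (by positivity),
      ← ENNReal.ofReal_mul (by positivity), ← ENNReal.ofReal_natCast N]
    congr 1
    have := Real.pi_pos.ne'
    push_cast
    field_simp
  · rw [sphereAreaMeasure, Measure.smul_apply, Measure.map_apply hm hs.compl, Set.preimage_compl,
      hpre]
    simp

/-- The uniform distribution on `S²_N`. -/
noncomputable def uniformSphere (N : ℕ) : Measure (EuclideanSpace ℝ (Fin 3)) :=
  cond (sphereAreaMeasure N) (sphereOfArea N)

/-- The square `[0, √n]²` in the Euclidean plane. -/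
def squareOfArea (n : ℕ) : Set (EuclideanSpace ℝ (Fin 2)) :=
  {x | ∀ i, x i ∈ Set.Icc (0 : ℝ) √n}

/-- The uniform distribution on the square `[0, √n]²`. -/
noncomputable def uniformSquare (n : ℕ) : Measure (EuclideanSpace ℝ (Fin 2)) :=
  cond volume (squareOfArea n)

/-- The random points `X₁, …, X_n, Y₁, …, Y_n` on the probability space `(Ω, P)` are independent and
all have the law `ν`. -/
structure IsIIDPair {Ω E : Type*} [MeasurableSpace Ω] [MeasurableSpace E] {n : ℕ}
    (X Y : Fin n → Ω → E) (ν : Measure E) (P : Measure Ω) : Prop where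
  indep : iIndepFun (Sum.elim X Y) P
  law_left : ∀ i, HasLaw (X i) ν P
  law_right : ∀ i, HasLaw (Y i) ν P

/-! The square is compared with a patch of the sphere in random position. Lambert's equal area
projection identifies a central part of a hemisphere with a planar square whose side is the radius
`r`. Each translate of `[0, √n]²` inside that square pulls back to a spherical patch `R` of area
`n`, hence of probability `n / N`, and sphere points conditioned to lie in `R` project to uniform
points of the square (`map_cond_sphericalSquare`).

Fix `R`. The number of the `N` points that fall in `R` has mean `n` and deviates from it by at most
`√n` on average (`lintegral_enorm_count_sub_le`). Given which indices fall in `R`, the points there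
are i.i.d. A matching on the sphere is restricted to `R`, points are added or dropped to reach
exactly `n` on each side, and broken pairs are rematched at cost at most `L = √2 √n`, the diameter
of the square (`lintegral_matchingCost_cond_le`). Wrong counts cost at most `L * 2√n`, which is
`O(1)` per point: this is the additive constant. What remains is the crossing cost: the length of
pairs inside `R`, plus `L` for each pair leaving `R`.

Now average over the position of `R`. A pair at distance `d` lies in the patch for a fraction `O(n /
N)` of the positions, at cost `O(d)`, and is cut for a fraction `O(√n d / N)`, at cost `O(√n)`. Both
contributions are `O(n d / N)` (`lintegral_crossingCost_le`), so the average crossing cost is `O(n /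
N)` times the matching cost on the sphere. This requires the admissible positions to fill an area of
order `N`, which holds for `n ≥ 51`; for smaller `n` the diameter of the square suffices. -/

open scoped ENNReal

/-! ### Matching costs with values in `[0, ∞]` -/

/-- The minimal total cost of a bijective matching, for a cost function with values in `[0, ∞]`. -/
noncomputable def matchingCost {α β : Type*} (c : α → β → ℝ≥0∞) {n : ℕ} (x : Fin n → α)
    (y : Fin n → β) : ℝ≥0∞ :=
  ⨅ σ : Equiv.Perm (Fin n), ∑ i, c (x i) (y (σ i))

theorem ofReal_minMatchingCost {E : Type*} [PseudoMetricSpace E] {n : ℕ} (a b : Fin n → E) :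
    ENNReal.ofReal (minMatchingCost a b) = matchingCost edist a b := by
  have h : ∀ σ : Equiv.Perm (Fin n), ENNReal.ofReal (∑ i, dist (a i) (b (σ i)))
      = ∑ i, edist (a i) (b (σ i)) := fun σ => by
    rw [ENNReal.ofReal_sum_of_nonneg fun _ _ => dist_nonneg]
    simp_rw [edist_dist]
  apply le_antisymm
  · refine le_iInf fun σ => ?_
    rw [← h]
    exact ENNReal.ofReal_le_ofReal (Finset.inf'_le _ (Finset.mem_univ σ))
  · obtain ⟨σ, -, hσ⟩ := Finset.exists_mem_eq_inf' (Finset.univ_nonempty)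
      fun σ : Equiv.Perm (Fin n) => ∑ i, dist (a i) (b (σ i))
    rw [minMatchingCost, hσ, h]
    exact iInf_le _ σ

theorem minMatchingCost_nonneg {E : Type*} [PseudoMetricSpace E] {n : ℕ} (a b : Fin n → E) :
    0 ≤ minMatchingCost a b :=
  (Finset.le_inf'_iff _ _).2 fun _ _ => Finset.sum_nonneg fun _ _ => dist_nonneg

theorem matchingCost_mono {α β : Type*} {c c' : α → β → ℝ≥0∞} {n : ℕ} {x : Fin n → α}
    {y : Fin n → β} (h : ∀ i j, c (x i) (y j) ≤ c' (x i) (y j)) :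
    matchingCost c x y ≤ matchingCost c' x y :=
  iInf_mono fun _ => Finset.sum_le_sum fun _ _ => h _ _

theorem matchingCost_le_mul {α β : Type*} {c : α → β → ℝ≥0∞} {n : ℕ} {x : Fin n → α}
    {y : Fin n → β} {L : ℝ≥0∞} (h : ∀ i j, c (x i) (y j) ≤ L) :
    matchingCost c x y ≤ n * L :=
  (iInf_le _ (Equiv.refl _)).trans <|
    (Finset.sum_le_sum fun i _ => h i _).trans (by simp)

theorem matchingCost_const_mul {α β : Type*} {c : α → β → ℝ≥0∞} {n : ℕ} {x : Fin n → α}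
    {y : Fin n → β} {k : ℝ≥0∞} (hk : k ≠ ∞) :
    matchingCost (fun a b => k * c a b) x y = k * matchingCost c x y := by
  simp_rw [matchingCost, ← Finset.mul_sum]
  rw [ENNReal.mul_iInf fun h => (hk h).elim]

theorem measurable_matchingCost {α β Ω : Type*} [MeasurableSpace α] [MeasurableSpace β]
    [MeasurableSpace Ω] {c : Ω → α → β → ℝ≥0∞}
    (hc : Measurable fun p : Ω × α × β => c p.1 p.2.1 p.2.2)
    {n : ℕ} {x : Fin n → Ω → α} {y : Fin n → Ω → β} (hx : ∀ i, Measurable (x i))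
    (hy : ∀ i, Measurable (y i)) :
    Measurable fun ω => matchingCost (c ω) (fun i => x i ω) (fun i => y i ω) := by
  refine Measurable.iInf fun σ => Finset.measurable_fun_sum _ fun i _ => ?_
  exact hc.comp (measurable_id.prodMk ((hx i).prodMk (hy (σ i))))

/-- Every fixed permutation competes in each of the minima. This is what lets a single matching of
the sphere points serve all positions of the patch. -/
theorem lintegral_matchingCost_le_matchingCost_lintegral {α β Ω : Type*} [MeasurableSpace Ω]
    {μ : Measure Ω} {c : Ω → α → β → ℝ≥0∞} (hc : ∀ a b, Measurable fun ω => c ω a b)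
    {n : ℕ} (x : Fin n → α) (y : Fin n → β) :
    ∫⁻ ω, matchingCost (c ω) x y ∂μ ≤ matchingCost (fun a b => ∫⁻ ω, c ω a b ∂μ) x y := by
  refine le_iInf fun σ => ?_
  rw [← lintegral_finsetSum _ fun i _ => hc _ _]
  exact lintegral_mono fun ω => iInf_le _ σ

/-! ### Restricting a matching to subfamilies -/

theorem exists_card_eq_subset_or_superset {ι : Type*} [Fintype ι] (I : Finset ι) {n : ℕ}
    (hn : n ≤ Fintype.card ι) : ∃ J : Finset ι, J.card = n ∧ (I ⊆ J ∨ J ⊆ I) := by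
  rcases le_total I.card n with h | h
  · obtain ⟨J, h1, h2⟩ := Finset.exists_superset_card_eq h hn
    exact ⟨J, h2, Or.inl h1⟩
  · obtain ⟨J, h1, h2⟩ := Finset.exists_subset_card_eq h
    exact ⟨J, h2, Or.inr h1⟩

/-- A matching of the points with indices in `I` and `J` that is part of a matching `τ` of a larger
family gives a matching of any two subfamilies of the same size `I'`, `J'`; the cost of the pairs
that have to be rematched is at most `L` each. -/
theorem matchingCost_subfamily_le {α β : Type*} {N n : ℕ} (c : α → β → ℝ≥0∞) (L : ℝ≥0∞)
    (u : Fin N → α) (u' : Fin N → β) (hL : ∀ i j, c (u i) (u' j) ≤ L)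
    (I I' J J' : Finset (Fin N)) (e : Fin n ≃ I') (f : Fin n ≃ J') (τ : Equiv.Perm (Fin N)) :
    matchingCost c (fun k => u (e k)) (fun k => u' (f k)) ≤
      (∑ i, if i ∈ I then (if τ i ∈ J then c (u i) (u' (τ i)) else L) else 0) +
        L * ((I' \ I).card + (J \ J').card) := by
  classical
  -- The pairs of `τ` that are kept. They form a partial injection into `J'`, which is extended to a
  -- bijection arbitrarily.
  let s : Finset (Fin n) := {k | (e k : Fin N) ∈ I ∧ τ (e k) ∈ J ∧ τ (e k) ∈ J'}
  have hcard : Fintype.card (Fin n) = J'.card := by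
    rw [Fintype.card_congr f, Fintype.card_coe]
  obtain ⟨g, hg⟩ := Finset.exists_equiv_extend_of_card_eq hcard (s := s)
    (f := fun k => τ (e k))
    (by
      intro j hj
      obtain ⟨k, hk, rfl⟩ := Finset.mem_image.1 hj
      exact (Finset.mem_filter.1 hk).2.2.2)
    (fun a _ b _ hab => e.injective (Subtype.ext (τ.injective hab)))
  refine (iInf_le _ (g.trans f.symm)).trans ?_
  let h : Fin N → ℝ≥0∞ :=
    fun i => if i ∈ I then (if τ i ∈ J then c (u i) (u' (τ i)) else L) else 0
  -- Each rematched pair is charged to its cause: `e k` was added to `I`, or its partner was dropped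
  -- from `J`, or its partner lies outside `J`, which `h` already prices at `L`.
  have key : ∀ k, c (u (e k)) (u' (f ((g.trans f.symm) k))) ≤
      h (e k) + L * ((if (e k : Fin N) ∈ I then 0 else 1) +
        (if τ (e k) ∈ J \ J' then 1 else 0)) := by
    intro k
    simp only [Equiv.trans_apply, Equiv.apply_symm_apply]
    by_cases h1 : (e k : Fin N) ∈ I
    · by_cases h2 : τ (e k) ∈ J
      · by_cases h3 : τ (e k) ∈ J'
        · rw [hg k (by simp [s, h1, h2, h3])]
          simp [h, h1, h2]
        · refine (hL _ _).trans ?_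
          simp [h1, h2, h3]
      · refine (hL _ _).trans ?_
        simp [h, h1, h2]
    · refine (hL _ _).trans ?_
      refine le_trans ?_ le_add_self
      rw [if_neg h1, mul_add, mul_one]
      exact le_self_add
  refine (Finset.sum_le_sum fun k _ => key k).trans ?_
  have hsum : ∀ F : Fin N → ℝ≥0∞, ∑ k, F (e k) = ∑ i ∈ I', F i := fun F => by
    rw [e.sum_comp (fun i : I' => F i), Finset.sum_coe_sort]
  rw [Finset.sum_add_distrib, ← Finset.mul_sum, Finset.sum_add_distrib, hsum h,
    hsum (fun i => if i ∈ I then 0 else 1), hsum (fun i => if τ i ∈ J \ J' then 1 else 0)]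
  have a1 : ∑ i ∈ I', (if i ∈ I then (0 : ℝ≥0∞) else 1) ≤ (I' \ I).card := by
    rw [Finset.sum_ite, Finset.sum_const_zero, zero_add, Finset.sum_const, nsmul_one,
      Finset.sdiff_eq_filter]
  have a2 : ∑ i ∈ I', (if τ i ∈ J \ J' then (1 : ℝ≥0∞) else 0) ≤ (J \ J').card := by
    refine (Finset.sum_le_sum_of_subset (Finset.subset_univ _)).trans ?_
    rw [Equiv.sum_comp τ (fun j => if j ∈ J \ J' then (1 : ℝ≥0∞) else 0), Finset.sum_boole,
      Finset.filter_mem_eq_inter, Finset.univ_inter]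
  exact add_le_add (Finset.sum_le_sum_of_subset (Finset.subset_univ _)) (by gcongr)

/-- For nested sets one difference is empty and the other has exactly the difference of the
cardinalities as its size. -/
theorem card_sdiff_le_of_subset_or_superset {ι : Type*} [DecidableEq ι] {I I' : Finset ι}
    (h : I ⊆ I' ∨ I' ⊆ I) :
    (((I' \ I).card : ℝ≥0∞) ≤ ‖(I.card : ℝ) - I'.card‖ₑ) ∧
    (((I \ I').card : ℝ≥0∞) ≤ ‖(I.card : ℝ) - I'.card‖ₑ) := by
  have aux : ∀ {A B : Finset ι}, A ⊆ B → ((B \ A).card : ℝ≥0∞) = ‖(A.card : ℝ) - B.card‖ₑ := by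
    intro A B hAB
    rw [Finset.card_sdiff_of_subset hAB, ← ofReal_norm, Real.norm_eq_abs, abs_sub_comm,
      abs_of_nonneg (sub_nonneg.2 (by exact_mod_cast Finset.card_le_card hAB)),
      ← Nat.cast_sub (Finset.card_le_card hAB), ENNReal.ofReal_natCast]
  rcases h with h | h
  · exact ⟨(aux h).le, by simp [Finset.sdiff_eq_empty_iff_subset.2 h]⟩
  · refine ⟨by simp [Finset.sdiff_eq_empty_iff_subset.2 h], ?_⟩
    rw [aux h, ← enorm_neg, neg_sub]

/-! ### Sample points in a region: their number and their conditional law -/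

/-- The count is a sum of independent indicators, so its variance is at most its mean `n`. The
injection `g` selects one of the two halves of the sample. -/
theorem lintegral_enorm_count_sub_le {α ι : Type*} [MeasurableSpace α] [Fintype ι] {ν : Measure α}
    [IsProbabilityMeasure ν] {R : Set α} (hR : MeasurableSet R) {N n : ℕ} (hn : 0 < n)
    (hνR : (N : ℝ) * ν.real R = n) {g : Fin N → ι} (hg : Function.Injective g) :
    ∫⁻ w : ι → α, ‖(∑ i, R.indicator (1 : α → ℝ) (w (g i))) - n‖ₑ ∂(Measure.pi fun _ => ν)
      ≤ ENNReal.ofReal √n := by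
  set P : Measure (ι → α) := Measure.pi fun _ => ν
  have hn' : (0 : ℝ) < √n := Real.sqrt_pos.2 (by exact_mod_cast hn)
  let ξ : Fin N → (ι → α) → ℝ := fun i w => R.indicator (1 : α → ℝ) (w (g i))
  have hmeas : Measurable (R.indicator (1 : α → ℝ)) := measurable_one.indicator hR
  have hξm : ∀ i, Measurable (ξ i) := fun i => hmeas.comp (measurable_pi_apply _)
  have hξb : ∀ i w, ‖ξ i w‖ ≤ 1 := fun i w => by
    by_cases h : w (g i) ∈ R <;> simp [ξ, h]
  have hL2 : ∀ i, MemLp (ξ i) 2 P := fun i =>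
    MemLp.of_bound (hξm i).aestronglyMeasurable 1 (.of_forall (hξb i))
  have hmean : ∀ i, ∫ w, ξ i w ∂P = ν.real R := fun i => by
    have hmp := measurePreserving_eval (fun _ : ι => ν) (g i)
    conv_rhs => rw [← integral_indicator_one hR, ← hmp.map_eq, integral_map hmp.measurable.aemeasurable
      hmeas.aestronglyMeasurable]
  have hind : iIndepFun ξ P :=
    (iIndepFun_pi (μ := fun _ : ι => ν) (X := fun _ => R.indicator (1 : α → ℝ))
      fun i => hmeas.aemeasurable).precomp hg
  have hvar : ∀ i, Var[ξ i; P] ≤ ν.real R := fun i => by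
    refine (variance_le_expectation_sq (hξm i).aestronglyMeasurable).trans ?_
    rw [← hmean i]
    refine le_of_eq (integral_congr_ae (.of_forall fun w => ?_))
    by_cases h : w (g i) ∈ R <;> simp [ξ, h]
  let S : (ι → α) → ℝ := ∑ i, ξ i
  have hSL2 : MemLp S 2 P := memLp_finsetSum' _ fun i _ => hL2 i
  have hS : ∫ w, S w ∂P = n := by
    simp only [S, Finset.sum_apply]
    rw [integral_finsetSum _ fun i _ => (hL2 i).integrable (by norm_num)]
    simp [hmean, hνR]
  have hVS : Var[S; P] ≤ n := by
    rw [IndepFun.variance_sum (fun i _ => hL2 i) fun i _ j _ hij => hind.indepFun hij]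
    refine (Finset.sum_le_sum fun i _ => hvar i).trans ?_
    simp [hνR]
  have hSsq : Integrable (fun w => (S w - n) ^ 2) P := (hSL2.sub (memLp_const _)).integrable_sq
  have hSi : Integrable (fun w => S w - n) P :=
    (hSL2.integrable (by norm_num)).sub (integrable_const _)
  have hVeq : ∫ w, (S w - n) ^ 2 ∂P ≤ n := by
    rw [variance_eq_integral hSL2.aemeasurable, hS] at hVS
    exact hVS
  have h1 : ∫ w, ‖S w - n‖ ∂P ≤ √n := by
    -- Pointwise `|t| ≤ t² / (2√n) + √n / 2`, from `(|t| - √n)² ≥ 0`; this takes the place of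
    -- Cauchy–Schwarz.
    calc ∫ w, ‖S w - n‖ ∂P ≤ ∫ w, ((S w - n) ^ 2 * (2 * √n)⁻¹ + √n / 2) ∂P := by
          refine integral_mono hSi.norm ((hSsq.mul_const _).add (integrable_const _)) fun w => ?_
          have := sq_nonneg (|S w - n| - √n)
          rw [sub_sq, sq_abs] at this
          simp only [Real.norm_eq_abs]
          rw [← sub_nonneg]
          have h2 : (S w - n) ^ 2 * (2 * √n)⁻¹ + √n / 2 - |S w - n| =
            ((S w - n) ^ 2 - 2 * |S w - n| * √n + √n ^ 2) * (2 * √n)⁻¹ := by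
            field_simp
            ring
          rw [h2]
          positivity
      _ = (∫ w, (S w - n) ^ 2 ∂P) * (2 * √n)⁻¹ + √n / 2 := by
          rw [integral_add (hSsq.mul_const _) (integrable_const _), integral_mul_const]
          simp
      _ ≤ n * (2 * √n)⁻¹ + √n / 2 := by gcongr
      _ = √n := by
          field_simp
          rw [Real.sq_sqrt (by positivity)]
          ring
  calc _ = ∫⁻ w, ‖S w - n‖ₑ ∂P := by simp [S, ξ]
    _ = ENNReal.ofReal (∫ w, ‖S w - n‖ ∂P) := (ofReal_integral_norm_eq_lintegral_enorm hSi).symm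
    _ ≤ _ := ENNReal.ofReal_le_ofReal h1

open Classical in
/-- The cost `c` for pairs of points in `R`, with the cost `L` for a point of `R` that is matched to a
point outside of `R`. -/
noncomputable def crossingCost {α : Type*} (R : Set α) (c : α → α → ℝ≥0∞) (L : ℝ≥0∞) (x y : α) :
    ℝ≥0∞ :=
  if x ∈ R then (if y ∈ R then c x y else L) else 0

open Classical in
-- Law of total probability: the first coordinate only decides the side of `R`, and the point itself
-- is redrawn from the conditional law. This decouples the pattern of membership in `R` from the
-- positions.
theorem map_ite_prod_cond_compl {α : Type*} [MeasurableSpace α] {ν : Measure α}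
    [IsProbabilityMeasure ν] {R : Set α} (hR : MeasurableSet R) (h0 : ν R ≠ 0) (h1 : ν Rᶜ ≠ 0) :
    (ν.prod ((ν[|R]).prod (ν[|Rᶜ]))).map
      (fun p : α × α × α => if p.1 ∈ R then p.2.1 else p.2.2) = ν := by
  have := cond_isProbabilityMeasure h0
  have := cond_isProbabilityMeasure h1
  ext s hs
  have hm : Measurable (fun p : α × α × α => if p.1 ∈ R then p.2.1 else p.2.2) :=
    Measurable.ite (measurable_fst hR) (by fun_prop) (by fun_prop)
  rw [Measure.map_apply hm hs]
  have hpre : (fun p : α × α × α => if p.1 ∈ R then p.2.1 else p.2.2) ⁻¹' s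
      = (R ×ˢ (s ×ˢ Set.univ)) ∪ (Rᶜ ×ˢ (Set.univ ×ˢ s)) := by
    ext ⟨w, u, v⟩
    by_cases h : w ∈ R <;> simp [h]
  have hdisj : Disjoint (R ×ˢ (s ×ˢ (Set.univ : Set α))) (Rᶜ ×ˢ ((Set.univ : Set α) ×ˢ s)) :=
    Set.Disjoint.set_prod_left disjoint_compl_right _ _
  rw [hpre, measure_union hdisj (hR.compl.prod (MeasurableSet.univ.prod hs))]
  simp only [Measure.prod_prod, measure_univ, mul_one, one_mul]
  rw [mul_comm, cond_mul_eq_inter hR, mul_comm, cond_mul_eq_inter hR.compl, Set.inter_comm,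
    Set.inter_comm Rᶜ, ← Set.sdiff_eq, measure_inter_add_sdiff s hR]

theorem ae_pi_forall_mem {α ι : Type*} [MeasurableSpace α] [Fintype ι] {ν : Measure α}
    [IsProbabilityMeasure ν] {S : Set α} (hS : ∀ᵐ x ∂ν, x ∈ S) :
    ∀ᵐ z ∂(Measure.pi fun _ : ι => ν), ∀ i, z i ∈ S :=
  ae_all_iff.2 fun i =>
    (measurePreserving_eval (fun _ : ι => ν) i).quasiMeasurePreserving.ae hS

theorem map_pi_precomp {α ι κ : Type*} [MeasurableSpace α] [Fintype ι] [Fintype κ] {ν : Measure α}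
    [IsProbabilityMeasure ν] {g : κ → ι} (hg : Function.Injective g) :
    (Measure.pi fun _ : ι => ν).map (fun z k => z (g k)) = Measure.pi fun _ : κ => ν := by
  have hind : iIndepFun (fun k (z : ι → α) => z (g k)) (Measure.pi fun _ : ι => ν) :=
    (iIndepFun_pi (μ := fun _ : ι => ν) (X := fun _ => id) fun i => aemeasurable_id).precomp hg
  rw [(iIndepFun_iff_map_fun_eq_pi_map fun k => (measurable_pi_apply _).aemeasurable).1 hind]
  congr 1
  ext1 k
  exact (measurePreserving_eval (fun _ : ι => ν) (g k)).map_eq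

open Classical in
theorem measurePreserving_ite_pi_cond {α ι : Type*} [MeasurableSpace α] [Fintype ι] {ν : Measure α}
    [IsProbabilityMeasure ν] {R : Set α} (hR : MeasurableSet R) (h0 : ν R ≠ 0) (h1 : ν Rᶜ ≠ 0) :
    MeasurePreserving
      (fun (p : (ι → α) × (ι → α) × (ι → α)) i => if p.1 i ∈ R then p.2.1 i else p.2.2 i)
      ((Measure.pi fun _ => ν).prod ((Measure.pi fun _ => ν[|R]).prod (Measure.pi fun _ => ν[|Rᶜ])))
      (Measure.pi fun _ => ν) := by
  have := cond_isProbabilityMeasure h0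
  have := cond_isProbabilityMeasure h1
  have e1 := (measurePreserving_arrowProdEquivProdArrow α α ι (fun _ => ν[|R])
    (fun _ => ν[|Rᶜ])).symm
  have e2 := (measurePreserving_arrowProdEquivProdArrow α (α × α) ι (fun _ => ν)
    (fun _ => (ν[|R]).prod (ν[|Rᶜ]))).symm
  have hφ : Measurable (fun p : α × α × α => if p.1 ∈ R then p.2.1 else p.2.2) :=
    Measurable.ite (measurable_fst hR) (by fun_prop) (by fun_prop)
  have hmap := map_ite_prod_cond_compl hR h0 h1
  have e3 : MeasurePreserving
      (fun (t : ι → α × α × α) i => if (t i).1 ∈ R then (t i).2.1 else (t i).2.2)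
      (Measure.pi fun _ => ν.prod ((ν[|R]).prod (ν[|Rᶜ]))) (Measure.pi fun _ => ν) := by
    refine ⟨measurable_pi_lambda _ fun i => hφ.comp (measurable_pi_apply i), ?_⟩
    have : ∀ i : ι, SigmaFinite ((ν.prod ((ν[|R]).prod (ν[|Rᶜ]))).map
      (fun p : α × α × α => if p.1 ∈ R then p.2.1 else p.2.2)) := fun _ => by
        rw [hmap]; infer_instance
    rw [Measure.pi_map_pi (μ := fun _ : ι => ν.prod ((ν[|R]).prod (ν[|Rᶜ])))
      (f := fun _ (p : α × α × α) => if p.1 ∈ R then p.2.1 else p.2.2) fun i => hφ.aemeasurable]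
    simp_rw [hmap]
  exact e3.comp (e2.comp ((MeasurePreserving.id _).prod e1))

theorem measurable_crossingCost {α : Type*} [MeasurableSpace α] {R : Set α} (hR : MeasurableSet R)
    {c : α → α → ℝ≥0∞} (hc : Measurable fun p : α × α => c p.1 p.2) (L : ℝ≥0∞) :
    Measurable fun p : α × α => crossingCost R c L p.1 p.2 :=
  Measurable.ite (measurable_fst hR)
    (Measurable.ite (measurable_snd hR) hc measurable_const) measurable_const

open Classical in
-- The point is the order of quantifiers: `g` depends on the pattern `w` alone, so the selected
-- points stay i.i.d. in `R` when `u` is random. If too few indices have `w` in `R`, the missing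
-- points are values of `u` that the spliced configuration does not use.
theorem matchingCost_subsample_le {α : Type*} {R : Set α} {c : α → α → ℝ≥0∞} {L : ℝ≥0∞}
    (hcL : ∀ x ∈ R, ∀ y ∈ R, c x y ≤ L) {n N : ℕ} (hnN : n ≤ N) (w : Fin N ⊕ Fin N → α) :
    ∃ g : Fin n ⊕ Fin n → Fin N ⊕ Fin N, Function.Injective g ∧
      ∀ u v : Fin N ⊕ Fin N → α, (∀ i, u i ∈ R) → (∀ i, v i ∈ Rᶜ) →
        matchingCost c (fun k => u (g (.inl k))) (fun k => u (g (.inr k))) ≤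
          matchingCost (crossingCost R c L)
            (fun i => if w (.inl i) ∈ R then u (.inl i) else v (.inl i))
            (fun i => if w (.inr i) ∈ R then u (.inr i) else v (.inr i)) +
          L * (‖(∑ i, R.indicator (1 : α → ℝ) (w (.inl i))) - n‖ₑ +
            ‖(∑ i, R.indicator (1 : α → ℝ) (w (.inr i))) - n‖ₑ) := by
  let I : Finset (Fin N) := {i | w (.inl i) ∈ R}
  let J : Finset (Fin N) := {i | w (.inr i) ∈ R}
  obtain ⟨I', hI', hII'⟩ := exists_card_eq_subset_or_superset I (n := n) (by simpa using hnN)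
  obtain ⟨J', hJ', hJJ'⟩ := exists_card_eq_subset_or_superset J (n := n) (by simpa using hnN)
  let e : Fin n ≃ I' := (Finset.equivFinOfCardEq hI').symm
  let f : Fin n ≃ J' := (Finset.equivFinOfCardEq hJ').symm
  refine ⟨Sum.map (fun k => e k) (fun k => f k), Function.Injective.sumMap
    (Subtype.val_injective.comp e.injective) (Subtype.val_injective.comp f.injective),
    fun u v hu hv => ?_⟩
  have hI : ∑ i, R.indicator (1 : α → ℝ) (w (.inl i)) = I.card := by
    simp [I, Set.indicator_apply]
  have hJ : ∑ i, R.indicator (1 : α → ℝ) (w (.inr i)) = J.card := by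
    simp [J, Set.indicator_apply]
  have h1 := (card_sdiff_le_of_subset_or_superset hII').1
  have h2 := (card_sdiff_le_of_subset_or_superset hJJ').2
  rw [hI' ] at h1
  rw [hJ'] at h2
  rw [hI, hJ, matchingCost.eq_1 (crossingCost R c L), ENNReal.iInf_add]
  refine le_iInf fun τ => ?_
  refine (matchingCost_subfamily_le c L (fun i => u (.inl i)) (fun i => u (.inr i))
    (fun i j => hcL _ (hu _) _ (hu _)) I I' J J' e f τ).trans ?_
  gcongr with i
  by_cases hi : w (.inl i) ∈ R
  · by_cases hj : w (.inr (τ i)) ∈ R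
    · simp [I, J, hi, hj, crossingCost, hu]
    · have := hv (.inr (τ i))
      simp_all [I, J, crossingCost]
  · simp [I, hi]

/-- Comparison of the expected cost of a minimal matching of `n` against `n` points that are
distributed according to `ν` conditioned on `R` with that of `N` against `N` points distributed
according to `ν`, when `R` contains `n` of the `N` points on average. -/
theorem lintegral_matchingCost_cond_le {α : Type*} [MeasurableSpace α] {ν : Measure α}
    [IsProbabilityMeasure ν] {R : Set α} (hR : MeasurableSet R) {c : α → α → ℝ≥0∞}
    (hc : Measurable fun p : α × α => c p.1 p.2) {L : ℝ≥0∞}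
    (hcL : ∀ x ∈ R, ∀ y ∈ R, c x y ≤ L) {n N : ℕ} (hn : 0 < n) (hnN : n < N)
    (hνR : (N : ℝ) * ν.real R = n) :
    ∫⁻ a, matchingCost c (fun k => a (.inl k)) (fun k => a (.inr k))
        ∂(Measure.pi fun _ : Fin n ⊕ Fin n => ν[|R]) ≤
      ∫⁻ z, matchingCost (crossingCost R c L) (fun k => z (.inl k)) (fun k => z (.inr k))
        ∂(Measure.pi fun _ : Fin N ⊕ Fin N => ν) +
      L * (2 * ENNReal.ofReal √n) := by
  classical
  have hn' : (0 : ℝ) < n := by exact_mod_cast hn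
  have hnN' : (n : ℝ) < N := by exact_mod_cast hnN
  have h0 : ν R ≠ 0 := fun h => by
    rw [measureReal_def, h] at hνR
    simp at hνR
    linarith
  have h1 : ν Rᶜ ≠ 0 := fun h => by
    rw [prob_compl_eq_zero_iff hR] at h
    rw [measureReal_def, h] at hνR
    simp at hνR
    linarith
  have := cond_isProbabilityMeasure h0
  have := cond_isProbabilityMeasure h1
  set m := ∫⁻ a, matchingCost c (fun k => a (.inl k)) (fun k => a (.inr k))
        ∂(Measure.pi fun _ : Fin n ⊕ Fin n => ν[|R]) with hm
  let F : (Fin N ⊕ Fin N → α) → ℝ≥0∞ := fun z =>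
    matchingCost (crossingCost R c L) (fun k => z (.inl k)) (fun k => z (.inr k))
  have hF : Measurable F :=
    measurable_matchingCost (c := fun _ => crossingCost R c L)
      ((measurable_crossingCost hR hc L).comp measurable_snd) (fun i => measurable_pi_apply _)
      (fun i => measurable_pi_apply _)
  let D : (Fin N ⊕ Fin N → α) → ℝ≥0∞ := fun w =>
    ‖(∑ i, R.indicator (1 : α → ℝ) (w (.inl i))) - n‖ₑ +
      ‖(∑ i, R.indicator (1 : α → ℝ) (w (.inr i))) - n‖ₑ
  have hone : Measurable (R.indicator (1 : α → ℝ)) := measurable_one.indicator hR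
  have hDm : ∀ g : Fin N → Fin N ⊕ Fin N,
      Measurable fun w : Fin N ⊕ Fin N → α => ‖(∑ i, R.indicator (1 : α → ℝ) (w (g i))) - n‖ₑ :=
    fun g => ((Finset.measurable_fun_sum _ fun i _ =>
      hone.comp (measurable_pi_apply _)).sub_const _).enorm
  have hDmeas : Measurable D := (hDm .inl).add (hDm .inr)
  have hD : ∫⁻ w, D w ∂(Measure.pi fun _ => ν) ≤ 2 * ENNReal.ofReal √n := by
    rw [lintegral_add_left (hDm .inl), two_mul]
    exact add_le_add (lintegral_enorm_count_sub_le hR hn hνR Sum.inl_injective)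
      (lintegral_enorm_count_sub_le hR hn hνR Sum.inr_injective)
  have hΨ := measurePreserving_ite_pi_cond (ι := Fin N ⊕ Fin N) hR h0 h1
  have key : ∀ w, m ≤ (∫⁻ q, F (fun i => if w i ∈ R then q.1 i else q.2 i)
      ∂((Measure.pi fun _ => ν[|R]).prod (Measure.pi fun _ => ν[|Rᶜ]))) + L * D w := fun w => by
    obtain ⟨g, hg, hgw⟩ := matchingCost_subsample_le hcL hnN.le w
    have hGm : Measurable fun a : Fin n ⊕ Fin n → α =>
        matchingCost c (fun k => a (.inl k)) (fun k => a (.inr k)) :=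
      measurable_matchingCost (c := fun _ => c) (hc.comp measurable_snd)
        (fun i => measurable_pi_apply _) (fun i => measurable_pi_apply _)
    have hgm : Measurable fun (z : Fin N ⊕ Fin N → α) (k : Fin n ⊕ Fin n) => z (g k) :=
      measurable_pi_lambda _ fun k => measurable_pi_apply _
    -- Whatever the pattern `w`, the selected coordinates of `q.1` are `n + n` i.i.d. points with
    -- law `ν[|R]`.
    have hm' : m = ∫⁻ q, matchingCost c (fun k => q.1 (g (.inl k))) (fun k => q.1 (g (.inr k)))
        ∂((Measure.pi fun _ : Fin N ⊕ Fin N => ν[|R]).prod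
          (Measure.pi fun _ : Fin N ⊕ Fin N => ν[|Rᶜ])) := by
      rw [hm, ← map_pi_precomp hg, lintegral_map hGm hgm]
      exact ((measurePreserving_fst (μ := Measure.pi fun _ : Fin N ⊕ Fin N => ν[|R])
        (ν := Measure.pi fun _ : Fin N ⊕ Fin N => ν[|Rᶜ])).lintegral_comp (hGm.comp hgm)).symm
    have hconst : L * D w = ∫⁻ _, L * D w
        ∂((Measure.pi fun _ : Fin N ⊕ Fin N => ν[|R]).prod
          (Measure.pi fun _ : Fin N ⊕ Fin N => ν[|Rᶜ])) := by simp
    rw [hm', hconst, ← lintegral_add_right _ measurable_const]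
    refine lintegral_mono_ae ?_
    filter_upwards [Measure.quasiMeasurePreserving_fst.ae (ae_pi_forall_mem (ae_cond_mem hR)),
      Measure.quasiMeasurePreserving_snd.ae (ae_pi_forall_mem (ae_cond_mem hR.compl))] with q hq1 hq2
    exact hgw q.1 q.2 hq1 hq2
  calc m = ∫⁻ _, m ∂(Measure.pi fun _ : Fin N ⊕ Fin N => ν) := by simp
    _ ≤ ∫⁻ w, ((∫⁻ q, F (fun i => if w i ∈ R then q.1 i else q.2 i)
      ∂((Measure.pi fun _ => ν[|R]).prod (Measure.pi fun _ => ν[|Rᶜ]))) + L * D w)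
        ∂(Measure.pi fun _ : Fin N ⊕ Fin N => ν) := lintegral_mono key
    _ = (∫⁻ z, F z ∂(Measure.pi fun _ => ν)) + L * ∫⁻ w, D w ∂(Measure.pi fun _ => ν) := by
      rw [lintegral_add_right _ (hDmeas.const_mul L),
        lintegral_const_mul _ hDmeas, ← hΨ.lintegral_comp hF]
      exact congrArg (· + _) (lintegral_prod _ (hF.comp hΨ.measurable).aemeasurable).symm
    _ ≤ _ := by gcongr

/-! ### Lambert's projection and its inverse -/

open scoped Pointwise

/-- The closed square with centre `0` and half side length `d` in the plane. -/
def centredSquare (d : ℝ) : Set (EuclideanSpace ℝ (Fin 2)) := {q | ∀ i, |q i| ≤ d}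

open Classical in
/-- Lambert's azimuthal equal area projection from the upper half of the sphere of radius `r` to the
plane. The lower half of the sphere is sent to the point `(r, r)`. -/
noncomputable def lambert (r : ℝ) (p : EuclideanSpace ℝ (Fin 3)) : EuclideanSpace ℝ (Fin 2) :=
  if 0 ≤ p 2 then √(2 * r / (r + p 2)) • !₂[p 0, p 1] else !₂[r, r]

/-- The inverse of Lambert's projection of the unit sphere. -/
noncomputable def lambertInv (q : EuclideanSpace ℝ (Fin 2)) : EuclideanSpace ℝ (Fin 3) :=
  !₂[q 0 * √(1 - (q 0 ^ 2 + q 1 ^ 2) / 4), q 1 * √(1 - (q 0 ^ 2 + q 1 ^ 2) / 4),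
    1 - (q 0 ^ 2 + q 1 ^ 2) / 2]

theorem sq_add_sq_le_of_mem_centredSquare {q : EuclideanSpace ℝ (Fin 2)} {d : ℝ}
    (hq : q ∈ centredSquare d) : q 0 ^ 2 + q 1 ^ 2 ≤ 2 * d ^ 2 := by
  have h0 := sq_le_sq' (abs_le.1 (hq 0)).1 (abs_le.1 (hq 0)).2
  have h1 := sq_le_sq' (abs_le.1 (hq 1)).1 (abs_le.1 (hq 1)).2
  linarith

theorem measurable_lambert (r : ℝ) : Measurable (lambert r) := by
  refine Measurable.ite (measurableSet_le measurable_const (by fun_prop)) ?_ measurable_const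
  refine Measurable.smul
    (by fun_prop : Measurable fun p : EuclideanSpace ℝ (Fin 3) => √(2 * r / (r + p 2))) ?_
  refine (WithLp.measurable_toLp 2 (Fin 2 → ℝ)).comp (measurable_pi_lambda _ fun i => ?_)
  fin_cases i <;> simp <;> fun_prop

theorem sq_sum_eq_of_mem_sphere {p : EuclideanSpace ℝ (Fin 3)} {r : ℝ} (hp : ‖p‖ = r) :
    p 0 ^ 2 + p 1 ^ 2 + p 2 ^ 2 = r ^ 2 := by
  rw [← hp, EuclideanSpace.norm_sq_eq, Fin.sum_univ_three]
  simp

/-- Reduces area computations to the unit sphere; the default value `(r, r)` is chosen to scale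
along. -/
theorem lambert_smul {r : ℝ} (hr : 0 < r) (p : EuclideanSpace ℝ (Fin 3)) :
    lambert r (r • p) = r • lambert 1 p := by
  unfold lambert
  have h : (0 ≤ (r • p) 2) ↔ 0 ≤ p 2 := by simp [hr]
  by_cases h2 : 0 ≤ p 2
  · rw [if_pos h2, if_pos (h.2 h2)]
    have : 2 * r / (r + (r • p) 2) = 2 * 1 / (1 + p 2) := by
      simp only [PiLp.smul_apply, smul_eq_mul]
      field_simp
    rw [this]
    ext i
    fin_cases i <;> simp <;> ring
  · rw [if_neg h2, if_neg (mt h.1 h2)]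
    ext i
    fin_cases i <;> simp

theorem norm_lambertInv {q : EuclideanSpace ℝ (Fin 2)} (hq : q ∈ centredSquare (1 / 2)) :
    ‖lambertInv q‖ = 1 := by
  have hw := sq_add_sq_le_of_mem_centredSquare hq
  have hs := Real.sq_sqrt (show 0 ≤ 1 - (q 0 ^ 2 + q 1 ^ 2) / 4 by linarith)
  have h : ‖lambertInv q‖ ^ 2 = 1 := by
    rw [EuclideanSpace.norm_sq_eq, Fin.sum_univ_three]
    simp only [lambertInv, Real.norm_eq_abs, sq_abs, PiLp.toLp_apply, Matrix.cons_val]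
    rw [mul_pow, mul_pow, hs]
    ring
  exact (sq_eq_sq₀ (norm_nonneg _) zero_le_one).1 (by rw [h]; norm_num)

theorem lambert_lambertInv {q : EuclideanSpace ℝ (Fin 2)} (hq : q ∈ centredSquare (1 / 2)) :
    lambert 1 (lambertInv q) = q := by
  have hw := sq_add_sq_le_of_mem_centredSquare hq
  have h2 : lambertInv q 2 = 1 - (q 0 ^ 2 + q 1 ^ 2) / 2 := rfl
  have hpos : 0 < 1 - (q 0 ^ 2 + q 1 ^ 2) / 4 := by linarith
  have hs := Real.sqrt_pos.2 hpos
  rw [lambert, if_pos (by rw [h2]; linarith), h2]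
  have h3 : √(2 * 1 / (1 + (1 - (q 0 ^ 2 + q 1 ^ 2) / 2))) =
      (√(1 - (q 0 ^ 2 + q 1 ^ 2) / 4))⁻¹ := by
    rw [← Real.sqrt_inv]
    congr 1
    rw [div_eq_iff (by linarith), inv_mul_eq_div, eq_div_iff hpos.ne']
    ring
  have e : ∀ t : ℝ, (√(1 - (q 0 ^ 2 + q 1 ^ 2) / 4))⁻¹ *
      (t * √(1 - (q 0 ^ 2 + q 1 ^ 2) / 4)) = t := fun t => by
    rw [mul_comm t, inv_mul_cancel_left₀ hs.ne']
  rw [h3]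
  ext i
  fin_cases i
  · exact e (q 0)
  · exact e (q 1)

/-- As `d < r`, the default value `(r, r)` lies outside the square, so the lower half of the sphere
never interferes. -/
theorem lambert_apply_of_mem {p : EuclideanSpace ℝ (Fin 3)} {r d : ℝ} (hr : d < r)
    (h : lambert r p ∈ centredSquare d) :
    0 ≤ p 2 ∧ lambert r p = √(2 * r / (r + p 2)) • !₂[p 0, p 1] := by
  by_cases h2 : 0 ≤ p 2
  · exact ⟨h2, if_pos h2⟩
  · rw [lambert, if_neg h2] at h
    have := (le_abs_self _).trans (h 0)
    simp at this
    linarith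

theorem lambertInv_lambert {p : EuclideanSpace ℝ (Fin 3)} (hp : ‖p‖ = 1)
    (h : lambert 1 p ∈ centredSquare (1 / 2)) : lambertInv (lambert 1 p) = p := by
  obtain ⟨h2, hl⟩ := lambert_apply_of_mem (by norm_num) h
  have hsq := sq_sum_eq_of_mem_sphere hp
  have hk2 := Real.sq_sqrt (show 0 ≤ 2 * 1 / (1 + p 2) by positivity)
  have hk : 0 < √(2 * 1 / (1 + p 2)) := Real.sqrt_pos.2 (by positivity)
  rw [hl]
  set k := √(2 * 1 / (1 + p 2))
  have hw : (k * p 0) ^ 2 + (k * p 1) ^ 2 = 2 * (1 - p 2) := by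
    rw [mul_pow, mul_pow, hk2]
    field_simp
    linear_combination hsq
  have hf : √(1 - ((k * p 0) ^ 2 + (k * p 1) ^ 2) / 4) = k⁻¹ := by
    rw [hw, ← Real.sqrt_inv]
    congr 1
    field_simp
    ring
  ext i
  fin_cases i
  · simp [lambertInv, hf]
    field_simp
  · simp [lambertInv, hf]
    field_simp
  · simp [lambertInv, hw]

/-! ### Lambert's projection preserves area -/

/-- The cone over Lambert's parametrization of the unit sphere, in coordinates. -/
noncomputable def lambertCone (x : Fin 3 → ℝ) : Fin 3 → ℝ :=
  ![x 0 * (x 1 * √(1 - (x 1 ^ 2 + x 2 ^ 2) / 4)), x 0 * (x 2 * √(1 - (x 1 ^ 2 + x 2 ^ 2) / 4)),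
    x 0 * (1 - (x 1 ^ 2 + x 2 ^ 2) / 2)]

theorem toLp_lambertCone (x : Fin 3 → ℝ) :
    WithLp.toLp 2 (lambertCone x) = x 0 • lambertInv !₂[x 1, x 2] := by
  ext i
  fin_cases i <;> simp [lambertCone, lambertInv]

/-- The Jacobian matrix of `lambertCone`. -/
noncomputable def lambertConeJacobian (x : Fin 3 → ℝ) : Matrix (Fin 3) (Fin 3) ℝ :=
  let f := √(1 - (x 1 ^ 2 + x 2 ^ 2) / 4)
  !![x 1 * f, x 0 * (f - x 1 ^ 2 / (4 * f)), x 0 * (-(x 1 * x 2) / (4 * f));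
    x 2 * f, x 0 * (-(x 1 * x 2) / (4 * f)), x 0 * (f - x 2 ^ 2 / (4 * f));
    1 - (x 1 ^ 2 + x 2 ^ 2) / 2, -(x 0 * x 1), -(x 0 * x 2)]

/-- That the determinant is independent of `x 1` and `x 2` is the equal area property. -/
theorem det_lambertConeJacobian {x : Fin 3 → ℝ} (hx : x 1 ^ 2 + x 2 ^ 2 < 4) :
    (lambertConeJacobian x).det = x 0 ^ 2 := by
  have hpos : 0 < 1 - (x 1 ^ 2 + x 2 ^ 2) / 4 := by linarith
  have hs := Real.sqrt_pos.2 hpos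
  have h2 := Real.sq_sqrt hpos.le
  rw [lambertConeJacobian, Matrix.det_fin_three]
  set f := √(1 - (x 1 ^ 2 + x 2 ^ 2) / 4)
  simp
  field_simp
  rw [h2]
  ring

theorem hasFDerivAt_lambertCone {x : Fin 3 → ℝ} (hx : x 1 ^ 2 + x 2 ^ 2 < 4) :
    HasFDerivAt lambertCone (Matrix.toLin' (lambertConeJacobian x)).toContinuousLinearMap x := by
  have hpos : 0 < 1 - (x 1 ^ 2 + x 2 ^ 2) / 4 := by linarith
  have hs := Real.sqrt_pos.2 hpos
  have hc : ∀ i : Fin 3, HasFDerivAt (fun x : Fin 3 → ℝ => x i)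
    (ContinuousLinearMap.proj (R := ℝ) (φ := fun _ : Fin 3 => ℝ) i) x := fun i =>
      (ContinuousLinearMap.proj (R := ℝ) (φ := fun _ : Fin 3 => ℝ) i).hasFDerivAt
  have hw := ((hc 1).pow 2).add ((hc 2).pow 2)
  have hf := ((hw.mul_const (1 / 4)).const_sub 1).sqrt (by simp; linarith)
  refine hasFDerivAt_pi'.2 fun i => ?_
  fin_cases i
  · have h := (hc 0).mul ((hc 1).mul hf)
    refine (h.congr_fderiv ?_).congr_of_eventuallyEq (.of_forall fun y => ?_)
    · ext v
      simp [Matrix.toLin'_apply, dotProduct, Fin.sum_univ_three, lambertConeJacobian,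
        ← div_eq_mul_inv]
      generalize √(1 - (x 1 ^ 2 + x 2 ^ 2) / 4) = f at hs
      field_simp
      ring
    · simp [lambertCone, ← div_eq_mul_inv]
  · have h := (hc 0).mul ((hc 2).mul hf)
    refine (h.congr_fderiv ?_).congr_of_eventuallyEq (.of_forall fun y => ?_)
    · ext v
      simp [Matrix.toLin'_apply, dotProduct, Fin.sum_univ_three, lambertConeJacobian,
        ← div_eq_mul_inv]
      generalize √(1 - (x 1 ^ 2 + x 2 ^ 2) / 4) = f at hs
      field_simp
      ring
    · simp [lambertCone, ← div_eq_mul_inv]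
  · have h := (hc 0).mul ((hw.mul_const (1 / 2)).const_sub 1)
    refine (h.congr_fderiv ?_).congr_of_eventuallyEq (.of_forall fun y => ?_)
    · ext v
      simp [Matrix.toLin'_apply, dotProduct, Fin.sum_univ_three, lambertConeJacobian]
      ring
    · simp [lambertCone]
      ring_nf
      simp

theorem map_cons_tail_volume :
    MeasurePreserving (fun x : Fin 3 → ℝ => (x 0, (!₂[x 1, x 2] : EuclideanSpace ℝ (Fin 2))))
      volume (volume.prod volume) := by
  have h1 := volume_preserving_piFinSuccAbove (fun _ : Fin 3 => ℝ) 0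
  have h2 := (MeasurePreserving.id (volume : Measure ℝ)).prod
    (PiLp.volume_preserving_toLp (Fin 2))
  have e : (fun x : Fin 3 → ℝ => (x 0, (!₂[x 1, x 2] : EuclideanSpace ℝ (Fin 2)))) =
      Prod.map id (WithLp.toLp 2) ∘ MeasurableEquiv.piFinSuccAbove (fun _ : Fin 3 => ℝ) 0 := by
    funext x
    refine Prod.ext (by simp) ?_
    ext i
    fin_cases i <;> simp [Fin.tail]
  rw [e]
  exact h2.comp h1

theorem lintegral_Ioo_sq : ∫⁻ t in Set.Ioo (0 : ℝ) 1, ENNReal.ofReal (t ^ 2) = 3⁻¹ := by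
  rw [← ofReal_integral_eq_lintegral_ofReal]
  · rw [← integral_Ioc_eq_integral_Ioo, ← intervalIntegral.integral_of_le zero_le_one, integral_pow]
    norm_num [ENNReal.ofReal_div_of_pos]
  · exact ((continuous_pow 2).integrableOn_Icc (a := 0) (b := 1)).mono_set Set.Ioo_subset_Icc_self
  · exact .of_forall fun t => sq_nonneg t

theorem volume_image_lambertCone {S : Set (EuclideanSpace ℝ (Fin 2))} (hS : MeasurableSet S)
    (hSD : S ⊆ centredSquare (1 / 2)) :
    volume (lambertCone '' {x | x 0 ∈ Set.Ioo (0 : ℝ) 1 ∧ !₂[x 1, x 2] ∈ S}) = 3⁻¹ * volume S := by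
  have hmp := map_cons_tail_volume
  set T : Set (Fin 3 → ℝ) := {x | x 0 ∈ Set.Ioo (0 : ℝ) 1 ∧ !₂[x 1, x 2] ∈ S}
  have hT : T = (fun x : Fin 3 → ℝ => (x 0, (!₂[x 1, x 2] : EuclideanSpace ℝ (Fin 2)))) ⁻¹'
    (Set.Ioo 0 1 ×ˢ S) := rfl
  have hTm : MeasurableSet T := hmp.measurable (measurableSet_Ioo.prod hS)
  have hlt : ∀ x ∈ T, x 1 ^ 2 + x 2 ^ 2 < 4 := fun x hx => by
    have := sq_add_sq_le_of_mem_centredSquare (hSD hx.2)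
    simp at this
    linarith
  have hinj : Set.InjOn lambertCone T := by
    -- The norm recovers the dilation factor `x 0`, and Lambert's projection recovers the other two
    -- coordinates.
    intro x hx y hy hxy
    have hxy' := congrArg (WithLp.toLp 2) hxy
    rw [toLp_lambertCone, toLp_lambertCone] at hxy'
    have hn := congrArg norm hxy'
    rw [norm_smul, norm_smul, norm_lambertInv (hSD hx.2), norm_lambertInv (hSD hy.2), mul_one,
      mul_one, Real.norm_of_nonneg hx.1.1.le, Real.norm_of_nonneg hy.1.1.le] at hn
    rw [hn] at hxy'
    have h := congrArg (lambert 1) (smul_right_injective _ hy.1.1.ne' hxy')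
    rw [lambert_lambertInv (hSD hx.2), lambert_lambertInv (hSD hy.2)] at h
    have h1 := congrArg (fun q : EuclideanSpace ℝ (Fin 2) => q 0) h
    have h2 := congrArg (fun q : EuclideanSpace ℝ (Fin 2) => q 1) h
    ext i
    fin_cases i
    · exact hn
    · exact h1
    · exact h2
  rw [← lintegral_abs_det_fderiv_eq_addHaar_image volume hTm
    (fun x hx => (hasFDerivAt_lambertCone (hlt x hx)).hasFDerivWithinAt) hinj]
  calc _ = ∫⁻ x in T, ENNReal.ofReal (x 0 ^ 2) := by
        refine setLIntegral_congr_fun hTm fun x hx => ?_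
        rw [ContinuousLinearMap.det, LinearMap.coe_toContinuousLinearMap, LinearMap.det_toLin',
          det_lambertConeJacobian (hlt x hx), abs_of_nonneg (sq_nonneg _)]
    _ = ∫⁻ q in Set.Ioo (0 : ℝ) 1 ×ˢ S, ENNReal.ofReal (q.1 ^ 2) ∂(volume.prod volume) :=
        hmp.setLIntegral_comp_preimage (measurableSet_Ioo.prod hS)
          (f := fun q : ℝ × EuclideanSpace ℝ (Fin 2) => ENNReal.ofReal (q.1 ^ 2)) (by fun_prop)
    _ = 3⁻¹ * volume S := by
        rw [← Measure.prod_restrict, ← lintegral_Ioo_sq]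
        have := lintegral_prod_mul (μ := volume.restrict (Set.Ioo (0 : ℝ) 1))
          (ν := volume.restrict S) (f := fun t => ENNReal.ofReal (t ^ 2)) (g := fun _ => 1)
          (by fun_prop) (by fun_prop)
        simpa using this

/-- `toSphere` is three times the volume of the cone over a set. That cone is an image under
`lambertCone`, and the `3` cancels `∫ t² = 1/3`. -/
theorem toSphere_preimage_lambert {S : Set (EuclideanSpace ℝ (Fin 2))} (hS : MeasurableSet S)
    (hSD : S ⊆ centredSquare (1 / 2)) :
    (volume : Measure (EuclideanSpace ℝ (Fin 3))).toSphere {u | lambert 1 u ∈ S} = volume S := by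
  have hm : MeasurableSet {u : Metric.sphere (0 : EuclideanSpace ℝ (Fin 3)) 1 |
      lambert 1 u ∈ S} := (measurable_lambert 1).comp measurable_subtype_coe hS
  rw [Measure.toSphere_apply' _ hm]
  have hset : (WithLp.toLp 2 : (Fin 3 → ℝ) → EuclideanSpace ℝ (Fin 3)) ⁻¹'
      (Set.Ioo (0 : ℝ) 1 • (Subtype.val '' {u : Metric.sphere (0 : EuclideanSpace ℝ (Fin 3)) 1 |
        lambert 1 u ∈ S})) =
      lambertCone '' {x | x 0 ∈ Set.Ioo (0 : ℝ) 1 ∧ !₂[x 1, x 2] ∈ S} := by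
    ext x
    simp only [Set.mem_preimage, Set.mem_smul, Set.mem_image, Set.mem_ofPred_eq]
    constructor
    · rintro ⟨ρ, hρ, _, ⟨u, hu, rfl⟩, hx⟩
      have hn : ‖(u : EuclideanSpace ℝ (Fin 3))‖ = 1 := by simp
      have hq : !₂[(lambert 1 (u : EuclideanSpace ℝ (Fin 3))) 0,
          (lambert 1 (u : EuclideanSpace ℝ (Fin 3))) 1] = lambert 1 u := by
        ext i
        fin_cases i <;> rfl
      refine ⟨![ρ, lambert 1 u 0, lambert 1 u 1], ⟨hρ, ?_⟩, ?_⟩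
      · simpa [hq] using hu
      · apply WithLp.toLp_injective 2
        rw [toLp_lambertCone, ← hx]
        simp only [Matrix.cons_val, hq]
        rw [lambertInv_lambert hn (hSD hu)]
    · rintro ⟨y, ⟨hy0, hyS⟩, rfl⟩
      refine ⟨y 0, hy0, lambertInv !₂[y 1, y 2],
        ⟨⟨_, mem_sphere_zero_iff_norm.2 (norm_lambertInv (hSD hyS))⟩, ?_, rfl⟩, (toLp_lambertCone y).symm⟩
      show lambert 1 (lambertInv !₂[y 1, y 2]) ∈ S
      rw [lambert_lambertInv (hSD hyS)]
      exact hyS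
  have hmp := (PiLp.volume_preserving_toLp (Fin 3)).measure_preimage_equiv
    (f := MeasurableEquiv.toLp 2 (Fin 3 → ℝ))
  rw [← hmp]
  erw [hset]
  rw [volume_image_lambertCone hS hSD, finrank_euclideanSpace, Fintype.card_fin, ← mul_assoc]
  simp [ENNReal.mul_inv_cancel]

/-! ### Lipschitz bound for Lambert's projection -/

theorem dist_le_of_abs_sub_le {x y : EuclideanSpace ℝ (Fin 2)} {a : ℝ} (h : ∀ i, |x i - y i| ≤ a) :
    dist x y ≤ √2 * a := by
  have ha : 0 ≤ a := (abs_nonneg _).trans (h 0)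
  rw [EuclideanSpace.dist_eq, Fin.sum_univ_two]
  refine Real.sqrt_le_iff.2 ⟨by positivity, ?_⟩
  rw [mul_pow, Real.sq_sqrt (by norm_num)]
  have h0 := pow_le_pow_left₀ (abs_nonneg _) (h 0) 2
  have h1 := pow_le_pow_left₀ (abs_nonneg _) (h 1) 2
  simp only [Real.dist_eq]
  linarith

/-- Only one point has to project into the square. If `q` is in the upper half, the factor `√(2r /
(r + z))` is at most `2` and is `1/r`-Lipschitz in the height `z`, which gives `2 + 1`. Otherwise
`p` and `q` are at least `3r/4` apart, while their images are at most `9r/4` apart. -/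
theorem dist_lambert_le {r : ℝ} (hr : 0 < r) {p q : EuclideanSpace ℝ (Fin 3)} (hp : ‖p‖ = r)
    (hq : ‖q‖ = r) (h : lambert r p ∈ centredSquare (r / 2)) :
    dist (lambert r p) (lambert r q) ≤ 3 * dist p q := by
  obtain ⟨hp2, hlp⟩ := lambert_apply_of_mem (by linarith) h
  have hsp := sq_sum_eq_of_mem_sphere hp
  have hsq := sq_sum_eq_of_mem_sphere hq
  have hz : |p 2 - q 2| ≤ dist p q := by
    rw [← Real.dist_eq]
    exact PiLp.dist_apply_le p q 2
  have hk : ∀ z, 0 ≤ z → z ≤ r → 1 ≤ √(2 * r / (r + z)) ∧ √(2 * r / (r + z)) ≤ 2 := by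
    intro z h0 h1
    constructor
    · rw [Real.one_le_sqrt, le_div_iff₀ (by linarith)]
      linarith
    · rw [Real.sqrt_le_left (by norm_num), div_le_iff₀ (by linarith)]
      linarith
  have hp2r : p 2 ≤ r := by nlinarith [sq_nonneg (p 0), sq_nonneg (p 1)]
  have hq2r : q 2 ≤ r := by nlinarith [sq_nonneg (q 0), sq_nonneg (q 1)]
  by_cases hq2 : 0 ≤ q 2
  · rw [hlp, lambert, if_pos hq2]
    obtain ⟨hkp1, hkp2⟩ := hk _ hp2 hp2r
    obtain ⟨hkq1, hkq2⟩ := hk _ hq2 hq2r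
    have hkp := Real.sq_sqrt (show 0 ≤ 2 * r / (r + p 2) by positivity)
    have hkq := Real.sq_sqrt (show 0 ≤ 2 * r / (r + q 2) by positivity)
    set a := √(2 * r / (r + p 2))
    set b := √(2 * r / (r + q 2))
    have hab : |a - b| * r ≤ dist p q := by
      have h1 : |a - b| * (a + b) = 2 * r * |p 2 - q 2| / ((r + p 2) * (r + q 2)) := by
        rw [← abs_of_pos (show 0 < a + b by linarith), ← abs_mul,
          show (a - b) * (a + b) = a ^ 2 - b ^ 2 by ring, hkp, hkq,
          show 2 * r / (r + p 2) - 2 * r / (r + q 2) =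
            2 * r * (q 2 - p 2) / ((r + p 2) * (r + q 2)) by field_simp; ring,
          abs_div, abs_mul, abs_of_pos (show 0 < 2 * r by linarith), abs_sub_comm,
          abs_of_pos (show 0 < (r + p 2) * (r + q 2) by positivity)]
      have h2 : 2 * r * |p 2 - q 2| / ((r + p 2) * (r + q 2)) ≤ 2 * r * |p 2 - q 2| / (r * r) := by
        gcongr <;> linarith
      have h3 : |a - b| * 2 ≤ |a - b| * (a + b) :=
        mul_le_mul_of_nonneg_left (by linarith) (abs_nonneg _)
      have h4 : |a - b| * 2 ≤ 2 * r * |p 2 - q 2| / (r * r) := h3.trans (h1.le.trans h2)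
      rw [le_div_iff₀ (by positivity)] at h4
      have h5 : (|a - b| * r) * (2 * r) ≤ |p 2 - q 2| * (2 * r) := by linarith
      exact (le_of_mul_le_mul_right h5 (by positivity)).trans hz
    have hproj : ∀ v : EuclideanSpace ℝ (Fin 3), ‖(!₂[v 0, v 1] : EuclideanSpace ℝ (Fin 2))‖ ≤ ‖v‖ := by
      intro v
      rw [EuclideanSpace.norm_eq, EuclideanSpace.norm_eq, Fin.sum_univ_two, Fin.sum_univ_three]
      refine Real.sqrt_le_sqrt ?_
      simp [sq_nonneg]
    have e : a • (!₂[p 0, p 1] : EuclideanSpace ℝ (Fin 2)) - b • !₂[q 0, q 1] =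
        a • !₂[(p - q) 0, (p - q) 1] + (a - b) • !₂[q 0, q 1] := by
      ext i
      fin_cases i <;> simp <;> ring
    rw [dist_eq_norm, e]
    refine (norm_add_le _ _).trans ?_
    rw [norm_smul, norm_smul, Real.norm_of_nonneg (by linarith : 0 ≤ a), Real.norm_eq_abs]
    have h1 : a * ‖(!₂[(p - q) 0, (p - q) 1] : EuclideanSpace ℝ (Fin 2))‖ ≤ 2 * dist p q := by
      rw [dist_eq_norm]
      exact mul_le_mul hkp2 (hproj _) (norm_nonneg _) (by norm_num)
    have h2 : |a - b| * ‖(!₂[q 0, q 1] : EuclideanSpace ℝ (Fin 2))‖ ≤ dist p q :=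
      (mul_le_mul_of_nonneg_left ((hproj q).trans hq.le) (abs_nonneg _)).trans hab
    linarith
  -- The projection of `p` has squared norm `2r(r - p 2)`, which is at most `2(r/2)²` in the square.
  · have hp2' : 3 / 4 * r ≤ p 2 := by
      have hw := sq_add_sq_le_of_mem_centredSquare h
      have hkp := Real.sq_sqrt (show 0 ≤ 2 * r / (r + p 2) by positivity)
      rw [hlp] at hw
      simp only [PiLp.smul_apply, Matrix.cons_val, smul_eq_mul] at hw
      rw [mul_pow, mul_pow, hkp] at hw
      have e : 2 * r / (r + p 2) * p 0 ^ 2 + 2 * r / (r + p 2) * p 1 ^ 2 = 2 * r * (r - p 2) := by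
        field_simp
        linear_combination hsp
      rw [e] at hw
      nlinarith
    have h1 : dist (lambert r p) (lambert r q) ≤ √2 * (3 / 2 * r) := by
      refine dist_le_of_abs_sub_le fun i => ?_
      have h3 : lambert r q i = r := by
        rw [lambert, if_neg hq2]
        fin_cases i <;> rfl
      have := abs_le.1 (h i)
      rw [h3, abs_le]
      constructor <;> linarith
    have h2 : √2 ≤ 3 / 2 := by
      rw [Real.sqrt_le_left (by norm_num)]
      norm_num
    have h4 := (le_abs_self _).trans hz
    push Not at hq2
    have : √2 * (3 / 2 * r) ≤ 3 / 2 * (3 / 2 * r) := by gcongr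
    linarith

/-! ### Uniform laws, and squares translated over the sphere -/

theorem sphereRadius_pos {N : ℕ} (hN : 0 < N) : 0 < sphereRadius N := by
  have : (0 : ℝ) < N := by exact_mod_cast hN
  exact Real.sqrt_pos.2 (by positivity)

theorem isProbabilityMeasure_uniformSphere {N : ℕ} (hN : 0 < N) :
    IsProbabilityMeasure (uniformSphere N) := by
  refine cond_isProbabilityMeasure_of_finite ?_ ?_ <;>
    rw [(sphereAreaMeasure_sphereOfArea N).1]
  · exact_mod_cast hN.ne'
  · exact ENNReal.natCast_ne_top N

theorem ae_uniformSphere_norm (N : ℕ) : ∀ᵐ p ∂uniformSphere N, ‖p‖ = sphereRadius N := by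
  filter_upwards [ae_cond_mem (μ := sphereAreaMeasure N) (s := sphereOfArea N)
    Metric.isClosed_sphere.measurableSet] with p hp
  exact mem_sphere_zero_iff_norm.1 hp

theorem uniformSphere_preimage_lambert {N : ℕ} (hN : 0 < N) {S : Set (EuclideanSpace ℝ (Fin 2))}
    (hS : MeasurableSet S) (hSD : S ⊆ centredSquare (sphereRadius N / 2)) :
    uniformSphere N (lambert (sphereRadius N) ⁻¹' S) = (N : ℝ≥0∞)⁻¹ * volume S := by
  have hr := sphereRadius_pos hN
  set r := sphereRadius N with hrdef
  have hpre : MeasurableSet (lambert r ⁻¹' S) := measurable_lambert r hS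
  have hm : Measurable fun u : Metric.sphere (0 : EuclideanSpace ℝ (Fin 3)) 1 =>
      r • (u : EuclideanSpace ℝ (Fin 3)) := by fun_prop
  obtain ⟨hN1, hN2⟩ := sphereAreaMeasure_sphereOfArea N
  have hball : MeasurableSet (sphereOfArea N) := Metric.isClosed_sphere.measurableSet
  have hset : (fun u : Metric.sphere (0 : EuclideanSpace ℝ (Fin 3)) 1 =>
      r • (u : EuclideanSpace ℝ (Fin 3))) ⁻¹' (lambert r ⁻¹' S) =
      {u : Metric.sphere (0 : EuclideanSpace ℝ (Fin 3)) 1 |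
        lambert 1 u ∈ (fun q => r • q) ⁻¹' S} := by
    ext u
    simp [lambert_smul hr]
  have hsub : (fun q : EuclideanSpace ℝ (Fin 2) => r • q) ⁻¹' S ⊆ centredSquare (1 / 2) := by
    intro q hq i
    have := hSD hq i
    simp only [PiLp.smul_apply, smul_eq_mul, abs_mul, abs_of_pos hr] at this
    rw [div_eq_mul_one_div] at this
    exact le_of_mul_le_mul_left this hr
  rw [uniformSphere, cond_apply hball, hN1, Set.inter_comm, measure_inter_conull hN2,
    sphereAreaMeasure, Measure.smul_apply, Measure.map_apply hm hpre, ← hrdef, hset,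
    toSphere_preimage_lambert (measurable_const_smul r hS) hsub,
    Measure.addHaar_preimage_smul volume hr.ne', finrank_euclideanSpace, Fintype.card_fin,
    smul_eq_mul, ← mul_assoc (ENNReal.ofReal (r ^ 2)), ← ENNReal.ofReal_mul (by positivity),
    abs_of_pos (by positivity), mul_inv_cancel₀ (by positivity), ENNReal.ofReal_one, one_mul]

theorem volume_box (a b : Fin 2 → ℝ) :
    volume {x : EuclideanSpace ℝ (Fin 2) | ∀ i, x i ∈ Set.Icc (a i) (b i)} =
      ENNReal.ofReal (b 0 - a 0) * ENNReal.ofReal (b 1 - a 1) := by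
  have h : {x : EuclideanSpace ℝ (Fin 2) | ∀ i, x i ∈ Set.Icc (a i) (b i)} =
      WithLp.ofLp ⁻¹' (Set.Icc a b) := by
    ext x
    simp [Pi.le_def, forall_and]
  rw [h, (PiLp.volume_preserving_ofLp (Fin 2)).measure_preimage
    measurableSet_Icc.nullMeasurableSet, Real.volume_Icc_pi, Fin.prod_univ_two]

theorem measurableSet_squareOfArea (n : ℕ) : MeasurableSet (squareOfArea n) := by
  simp only [squareOfArea, Set.ofPred_forall]
  exact MeasurableSet.iInter fun i =>
    (by fun_prop : Measurable fun x : EuclideanSpace ℝ (Fin 2) => x i) measurableSet_Icc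

theorem volume_squareOfArea (n : ℕ) : volume (squareOfArea n) = n := by
  have := volume_box (fun _ => 0) (fun _ => √n)
  rw [sub_zero, ← ENNReal.ofReal_mul (by positivity), Real.mul_self_sqrt (by positivity),
    ENNReal.ofReal_natCast] at this
  exact this

theorem isProbabilityMeasure_uniformSquare {n : ℕ} (hn : 0 < n) :
    IsProbabilityMeasure (uniformSquare n) := by
  refine cond_isProbabilityMeasure_of_finite ?_ ?_ <;> rw [volume_squareOfArea]
  · exact_mod_cast hn.ne'
  · exact ENNReal.natCast_ne_top n

theorem dist_le_of_mem_squareOfArea {n : ℕ} {x y : EuclideanSpace ℝ (Fin 2)}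
    (hx : x ∈ squareOfArea n) (hy : y ∈ squareOfArea n) : dist x y ≤ √2 * √n := by
  refine dist_le_of_abs_sub_le fun i => abs_le.2 ?_
  have h1 := hx i
  have h2 := hy i
  constructor <;> linarith [h1.1, h1.2, h2.1, h2.2]

/-- The part of the square that is moved out of it by a translation. -/
theorem volume_squareOfArea_diff_translate_le (n : ℕ) (h : EuclideanSpace ℝ (Fin 2)) :
    volume {z | z ∈ squareOfArea n ∧ z + h ∉ squareOfArea n} ≤
      2 * (ENNReal.ofReal √n * ‖h‖ₑ) := by
  -- A point can only leave from a strip of width `|h i|` along one side; the sign of `h i` decides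
  -- which side.
  let c : Fin 2 → ℝ := fun i => if 0 ≤ h i then √n - h i else 0
  have hsub : {z | z ∈ squareOfArea n ∧ z + h ∉ squareOfArea n} ⊆
      {z | ∀ i, z i ∈ Set.Icc ((![c 0, 0] : Fin 2 → ℝ) i) ((![c 0 + |h 0|, √n] : Fin 2 → ℝ) i)} ∪
      {z | ∀ i, z i ∈ Set.Icc ((![0, c 1] : Fin 2 → ℝ) i) ((![√n, c 1 + |h 1|] : Fin 2 → ℝ) i)} := by
    rintro z ⟨hz, hzh⟩
    have key : ∀ i, ¬ (z + h) i ∈ Set.Icc (0 : ℝ) √n → z i ∈ Set.Icc (c i) (c i + |h i|) := by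
      intro i hi
      have hzi := hz i
      simp only [PiLp.add_apply, Set.mem_Icc, not_and_or, not_le, c] at hi hzi ⊢
      split_ifs with h0
      · rw [abs_of_nonneg h0]
        constructor <;> rcases hi with hi | hi <;> linarith [hzi.1, hzi.2]
      · rw [abs_of_neg (not_le.1 h0)]
        constructor <;> rcases hi with hi | hi <;> linarith [hzi.1, hzi.2]
    simp only [squareOfArea, Set.mem_ofPred_eq, not_forall] at hzh
    obtain ⟨i, hi⟩ := hzh
    have := key i hi
    fin_cases i
    · left
      intro j
      fin_cases j
      · exact this
      · exact hz 1
    · right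
      intro j
      fin_cases j
      · exact hz 0
      · exact this
  have hle : ∀ i, ENNReal.ofReal |h i| ≤ ‖h‖ₑ := fun i => by
    rw [← ofReal_norm, ← Real.norm_eq_abs]
    exact ENNReal.ofReal_le_ofReal (PiLp.norm_apply_le h i)
  refine (measure_mono hsub).trans ((measure_union_le _ _).trans ?_)
  rw [volume_box, volume_box, two_mul]
  simp only [Matrix.cons_val, add_sub_cancel_left, sub_zero]
  refine add_le_add ?_ ?_
  · rw [mul_comm]
    gcongr
    exact hle 0
  · gcongr
    exact hle 1

/-- The part of the sphere of area `N` that Lambert's projection sends to the square with lower left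
corner `q`. -/
noncomputable def sphericalSquare (N n : ℕ) (q : EuclideanSpace ℝ (Fin 2)) :
    Set (EuclideanSpace ℝ (Fin 3)) :=
  {p | lambert (sphereRadius N) p - q ∈ squareOfArea n}

/-- The lower left corners of the squares of area `n` that are contained in the square with centre `0`
and half side length `r / 2`, where `r` is the radius of the sphere of area `N`. -/
noncomputable def cornerSet (N n : ℕ) : Set (EuclideanSpace ℝ (Fin 2)) :=
  {q | ∀ i, q i ∈ Set.Icc (-(sphereRadius N / 2)) (sphereRadius N / 2 - √n)}

theorem measurableSet_cornerSet (N n : ℕ) : MeasurableSet (cornerSet N n) := by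
  simp only [cornerSet, Set.ofPred_forall]
  exact MeasurableSet.iInter fun i =>
    (by fun_prop : Measurable fun x : EuclideanSpace ℝ (Fin 2) => x i) measurableSet_Icc

theorem mem_centredSquare_of_sub_mem {N n : ℕ} {q x : EuclideanSpace ℝ (Fin 2)}
    (hq : q ∈ cornerSet N n) (hx : x - q ∈ squareOfArea n) :
    x ∈ centredSquare (sphereRadius N / 2) := by
  intro i
  have h1 := hq i
  have h2 := hx i
  simp only [PiLp.sub_apply, Set.mem_Icc] at h1 h2
  rw [abs_le]
  constructor <;> linarith

theorem measurableSet_sphericalSquare (N n : ℕ) (q : EuclideanSpace ℝ (Fin 2)) :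
    MeasurableSet (sphericalSquare N n q) :=
  ((measurable_lambert _).sub_const q) (measurableSet_squareOfArea n)

theorem uniformSphere_sphericalSquare_inter {N n : ℕ} (hN : 0 < N) {q : EuclideanSpace ℝ (Fin 2)}
    (hq : q ∈ cornerSet N n) {s : Set (EuclideanSpace ℝ (Fin 2))} (hs : MeasurableSet s) :
    uniformSphere N (sphericalSquare N n q ∩ {p | lambert (sphereRadius N) p - q ∈ s}) =
      (N : ℝ≥0∞)⁻¹ * volume (squareOfArea n ∩ s) := by
  have hsub : Measurable fun x : EuclideanSpace ℝ (Fin 2) => x - q := by fun_prop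
  have := uniformSphere_preimage_lambert hN
    (hsub ((measurableSet_squareOfArea n).inter hs))
    fun x hx => mem_centredSquare_of_sub_mem hq hx.1
  rw [(measurePreserving_sub_right volume q).measure_preimage
    ((measurableSet_squareOfArea n).inter hs).nullMeasurableSet] at this
  exact this

/-- By the equal area property, conditioning on the patch and projecting gives normalized area; the
factors `1 / N` cancel. -/
theorem map_cond_sphericalSquare {N n : ℕ} (hN : 0 < N) {q : EuclideanSpace ℝ (Fin 2)}
    (hq : q ∈ cornerSet N n) :
    ((uniformSphere N)[|sphericalSquare N n q]).map (fun p => lambert (sphereRadius N) p - q) =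
      uniformSquare n := by
  have hN0 : (N : ℝ≥0∞) ≠ 0 := by exact_mod_cast hN.ne'
  have hm : Measurable fun p => lambert (sphereRadius N) p - q :=
    (measurable_lambert _).sub_const q
  ext s hs
  have huniv := uniformSphere_sphericalSquare_inter (n := n) hN hq MeasurableSet.univ
  simp only [Set.mem_univ, Set.ofPred_true, Set.inter_univ] at huniv
  have hpre : (fun p => lambert (sphereRadius N) p - q) ⁻¹' s =
    {p | lambert (sphereRadius N) p - q ∈ s} := rfl
  rw [Measure.map_apply hm hs, cond_apply (measurableSet_sphericalSquare N n q), hpre,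
    uniformSphere_sphericalSquare_inter hN hq hs, huniv, uniformSquare,
    cond_apply (measurableSet_squareOfArea n), ENNReal.mul_inv (.inl (by simp)) (.inl (by simp [hN.ne'])), inv_inv,
    mul_mul_mul_comm, ENNReal.mul_inv_cancel hN0 (ENNReal.natCast_ne_top N), one_mul]

/-- Let `e` be the distance of the projections. The corners whose patch contains `x` have area at
most `n` and account for at most `n e`. Those whose patch also excludes `y` have area at most `2√n
e`, at cost `√2 √n` each, which adds at most `4 n e`. Finally `e` is at most three times the
distance of `x` and `y`. -/
theorem lintegral_crossingCost_le {N n : ℕ} (hN : 0 < N) {x y : EuclideanSpace ℝ (Fin 3)}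
    (hx : ‖x‖ = sphereRadius N) (hy : ‖y‖ = sphereRadius N) :
    ∫⁻ q in cornerSet N n, crossingCost (sphericalSquare N n q)
        (fun p p' => edist (lambert (sphereRadius N) p) (lambert (sphereRadius N) p'))
        (ENNReal.ofReal (√2 * √n)) x y ≤ 15 * n * edist x y := by
  set r := sphereRadius N
  by_cases h : lambert r x ∈ centredSquare (r / 2)
  · let U : Set (EuclideanSpace ℝ (Fin 2)) := {q | lambert r x - q ∈ squareOfArea n}
    let V : Set (EuclideanSpace ℝ (Fin 2)) :=
      {q | lambert r x - q ∈ squareOfArea n ∧ lambert r y - q ∉ squareOfArea n}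
    have hsub : ∀ z : EuclideanSpace ℝ (Fin 2), Measurable fun q => z - q := fun z => by fun_prop
    have hU : MeasurableSet U := hsub _ (measurableSet_squareOfArea n)
    have hV : MeasurableSet V := hU.inter (hsub _ (measurableSet_squareOfArea n).compl)
    set e := edist (lambert r x) (lambert r y) with he
    have hvU : volume U = n := by
      have := (Measure.measurePreserving_sub_left volume (lambert r x)).measure_preimage
        (measurableSet_squareOfArea n).nullMeasurableSet
      rw [volume_squareOfArea] at this
      exact this
    have hvV : volume V ≤ 2 * (ENNReal.ofReal √n * e) := by
      have hW : MeasurableSet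
          {z | z ∈ squareOfArea n ∧ z + (lambert r y - lambert r x) ∉ squareOfArea n} :=
        (measurableSet_squareOfArea n).inter
          ((measurable_add_const (lambert r y - lambert r x)) (measurableSet_squareOfArea n).compl)
      have h1 := (Measure.measurePreserving_sub_left volume (lambert r x)).measure_preimage
        hW.nullMeasurableSet
      have h2 := volume_squareOfArea_diff_translate_le n (lambert r y - lambert r x)
      rw [← h1, ← edist_eq_enorm_sub, edist_comm] at h2
      refine le_trans (le_of_eq ?_) h2
      congr 1
      ext q
      simp [V]
    have he3 : e ≤ 3 * edist x y := by
      have := dist_lambert_le (sphereRadius_pos hN) hx hy h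
      rw [he, edist_dist, edist_dist, ← ENNReal.ofReal_ofNat 3, ← ENNReal.ofReal_mul (by norm_num)]
      exact ENNReal.ofReal_le_ofReal this
    calc _ ≤ ∫⁻ q in cornerSet N n, (U.indicator (fun _ => e) q +
            V.indicator (fun _ => ENNReal.ofReal (√2 * √n)) q) := by
          refine lintegral_mono fun q => ?_
          by_cases h1 : lambert r x - q ∈ squareOfArea n
          · by_cases h2 : lambert r y - q ∈ squareOfArea n <;>
              simp [crossingCost, sphericalSquare, U, V, h1, h2, r, e]
          · have : ¬ lambert (sphereRadius N) x - q ∈ squareOfArea n := h1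
            simp [crossingCost, sphericalSquare, this]
      _ ≤ ∫⁻ q, (U.indicator (fun _ => e) q +
            V.indicator (fun _ => ENNReal.ofReal (√2 * √n)) q) := setLIntegral_le_lintegral _ _
      _ = e * n + ENNReal.ofReal (√2 * √n) * volume V := by
          rw [lintegral_add_left (measurable_const.indicator hU), lintegral_indicator_const hU,
            lintegral_indicator_const hV, hvU]
      _ ≤ e * n + ENNReal.ofReal (√2 * √n) * (2 * (ENNReal.ofReal √n * e)) := by gcongr
      _ = e * n + 2 * ENNReal.ofReal √2 * (ENNReal.ofReal √n * ENNReal.ofReal √n) * e := by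
          rw [ENNReal.ofReal_mul (by positivity)]
          ring
      _ ≤ e * n + 2 * 2 * n * e := by
          rw [← ENNReal.ofReal_mul (by positivity), Real.mul_self_sqrt (by positivity),
            ENNReal.ofReal_natCast]
          gcongr
          rw [← ENNReal.ofReal_ofNat 2]
          refine ENNReal.ofReal_le_ofReal ?_
          rw [Real.sqrt_le_left (by norm_num)]
          norm_num
      _ = 5 * n * e := by ring
      _ ≤ 5 * n * (3 * edist x y) := by gcongr
      _ = 15 * n * edist x y := by ring
  · have : ∀ q ∈ cornerSet N n, crossingCost (sphericalSquare N n q)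
        (fun p p' => edist (lambert r p) (lambert r p'))
        (ENNReal.ofReal (√2 * √n)) x y = 0 := fun q hq =>
      if_neg fun hxq => h (mem_centredSquare_of_sub_mem hq hxq)
    rw [setLIntegral_congr_fun (measurableSet_cornerSet N n) this]
    simp

/-! ### Averaging over all positions of the patch -/

theorem measurable_matchingCost_sum {α : Type*} [MeasurableSpace α] {c : α → α → ℝ≥0∞}
    (hc : Measurable fun p : α × α => c p.1 p.2) (n : ℕ) :
    Measurable fun a : Fin n ⊕ Fin n → α =>
      matchingCost c (fun k => a (.inl k)) (fun k => a (.inr k)) :=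
  measurable_matchingCost (c := fun _ => c) (hc.comp measurable_snd)
    (fun _ => measurable_pi_apply _) (fun _ => measurable_pi_apply _)

/-- Only the joint law matters, so both expectations become integrals over product measures. -/
theorem integral_minMatchingCost {Ω E : Type*} [MeasurableSpace Ω] [PseudoMetricSpace E]
    [SecondCountableTopology E] [MeasurableSpace E] [OpensMeasurableSpace E] {n : ℕ}
    {P : Measure Ω} [IsProbabilityMeasure P] {ν : Measure E} {X Y : Fin n → Ω → E}
    (h : IsIIDPair X Y ν P) :
    ∫ ω, minMatchingCost (fun i => X i ω) (fun i => Y i ω) ∂P =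
      (∫⁻ z, matchingCost edist (fun k => z (.inl k)) (fun k => z (.inr k))
        ∂(Measure.pi fun _ : Fin n ⊕ Fin n => ν)).toReal := by
  have hm : ∀ i, AEMeasurable (Sum.elim X Y i) P := by
    rintro (i | i)
    · exact (h.law_left i).aemeasurable
    · exact (h.law_right i).aemeasurable
  have hmap : P.map (fun ω i => Sum.elim X Y i ω) = Measure.pi fun _ : Fin n ⊕ Fin n => ν := by
    rw [(iIndepFun_iff_map_fun_eq_pi_map hm).1 h.indep]
    congr 1
    ext1 i
    rcases i with i | i
    · exact (h.law_left i).map_eq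
    · exact (h.law_right i).map_eq
  have hF := measurable_matchingCost_sum (c := edist) (α := E) measurable_edist n
  have hΦ : AEMeasurable (fun ω i => Sum.elim X Y i ω) P := aemeasurable_pi_lambda _ hm
  have hint := integral_toReal (hF.comp_aemeasurable hΦ) (.of_forall fun ω => by
    simp only [Function.comp_apply, Sum.elim_inl, Sum.elim_inr]
    rw [← ofReal_minMatchingCost]
    exact ENNReal.ofReal_lt_top)
  simp only [Function.comp_apply, Sum.elim_inl, Sum.elim_inr, ← ofReal_minMatchingCost,
    ENNReal.toReal_ofReal (minMatchingCost_nonneg _ _)] at hint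
  rw [← hmap, lintegral_map' hF.aemeasurable hΦ]
  simp only [Sum.elim_inl, Sum.elim_inr, ← ofReal_minMatchingCost]
  exact hint

theorem lintegral_matchingCost_le_mul {α : Type*} [MeasurableSpace α] {ν : Measure α}
    [IsProbabilityMeasure ν] {c : α → α → ℝ≥0∞} {S : Set α} (hS : ∀ᵐ x ∂ν, x ∈ S) {L : ℝ≥0∞}
    (hL : ∀ x ∈ S, ∀ y ∈ S, c x y ≤ L) (n : ℕ) :
    ∫⁻ z, matchingCost c (fun k => z (.inl k)) (fun k => z (.inr k))
      ∂(Measure.pi fun _ : Fin n ⊕ Fin n => ν) ≤ n * L := by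
  calc _ ≤ ∫⁻ _, n * L ∂(Measure.pi fun _ : Fin n ⊕ Fin n => ν) := by
        refine lintegral_mono_ae ?_
        filter_upwards [ae_pi_forall_mem hS] with z hz
        exact matchingCost_le_mul fun i j => hL _ (hz _) _ (hz _)
    _ = n * L := by simp

theorem lintegral_matchingCost_map {α β : Type*} [MeasurableSpace α] [MeasurableSpace β]
    {ν : Measure α} [IsProbabilityMeasure ν] {g : α → β} (hg : Measurable g)
    {c : β → β → ℝ≥0∞} (hc : Measurable fun p : β × β => c p.1 p.2) (n : ℕ) :
    ∫⁻ z, matchingCost c (fun k => z (.inl k)) (fun k => z (.inr k))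
      ∂(Measure.pi fun _ : Fin n ⊕ Fin n => ν.map g) =
    ∫⁻ z, matchingCost (fun x y => c (g x) (g y)) (fun k => z (.inl k)) (fun k => z (.inr k))
      ∂(Measure.pi fun _ : Fin n ⊕ Fin n => ν) := by
  have := Measure.isProbabilityMeasure_map (μ := ν) hg.aemeasurable
  have hgm : Measurable fun (x : Fin n ⊕ Fin n → α) i => g (x i) :=
    measurable_pi_lambda _ fun i => hg.comp (measurable_pi_apply i)
  rw [← Measure.pi_map_pi (μ := fun _ : Fin n ⊕ Fin n => ν) (f := fun _ => g)
    fun _ => hg.aemeasurable, lintegral_map (measurable_matchingCost_sum hc n) hgm]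
  rfl

theorem volume_cornerSet (N n : ℕ) :
    volume (cornerSet N n) = ENNReal.ofReal (sphereRadius N - √n) ^ 2 := by
  have := volume_box (fun _ => -(sphereRadius N / 2)) (fun _ => sphereRadius N / 2 - √n)
  rw [← pow_two, show sphereRadius N / 2 - √n - -(sphereRadius N / 2) = sphereRadius N - √n by
    ring] at this
  exact this

theorem lintegral_uniformSquare_le {n N : ℕ} (hn : 0 < n) (hnN : n < N)
    {q : EuclideanSpace ℝ (Fin 2)} (hq : q ∈ cornerSet N n) :
    ∫⁻ a, matchingCost edist (fun k => a (.inl k)) (fun k => a (.inr k))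
        ∂(Measure.pi fun _ : Fin n ⊕ Fin n => uniformSquare n) ≤
      ∫⁻ z, matchingCost (crossingCost (sphericalSquare N n q)
        (fun p p' => edist (lambert (sphereRadius N) p) (lambert (sphereRadius N) p'))
        (ENNReal.ofReal (√2 * √n))) (fun k => z (.inl k)) (fun k => z (.inr k))
        ∂(Measure.pi fun _ : Fin N ⊕ Fin N => uniformSphere N) +
      ENNReal.ofReal (√2 * √n) * (2 * ENNReal.ofReal √n) := by
  have hN0 : 0 < N := hn.trans hnN
  have hnR : (0 : ℝ) < n := by exact_mod_cast hn
  have := isProbabilityMeasure_uniformSphere hN0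
  have hν : uniformSphere N (sphericalSquare N n q) = (N : ℝ≥0∞)⁻¹ * n := by
    have huniv := uniformSphere_sphericalSquare_inter (n := n) hN0 hq MeasurableSet.univ
    simpa [volume_squareOfArea] using huniv
  have hνR : (N : ℝ) * (uniformSphere N).real (sphericalSquare N n q) = n := by
    have : (0 : ℝ) < N := by exact_mod_cast hN0
    rw [measureReal_def, hν, ENNReal.toReal_mul, ENNReal.toReal_inv]
    simp only [ENNReal.toReal_natCast]
    field_simp
  have hν0 : uniformSphere N (sphericalSquare N n q) ≠ 0 := fun h => by
    rw [measureReal_def, h] at hνR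
    simp at hνR
    linarith
  have := cond_isProbabilityMeasure hν0
  have hlm := measurable_lambert (sphereRadius N)
  rw [← map_cond_sphericalSquare hN0 hq,
    lintegral_matchingCost_map (hlm.sub_const q) measurable_edist]
  simp_rw [edist_sub_right]
  refine lintegral_matchingCost_cond_le (measurableSet_sphericalSquare N n q)
    ((hlm.comp measurable_fst).edist (hlm.comp measurable_snd)) (fun x hx y hy => ?_) hn hnN hνR
  rw [edist_dist, ← dist_sub_right _ _ q]
  exact ENNReal.ofReal_le_ofReal (dist_le_of_mem_squareOfArea hx hy)

/-- Tonelli moves the average over `ω` next to the minimum, and a mean of minima is at most the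
minimum of the means. -/
theorem lintegral_lintegral_matchingCost_le {Ω α : Type*} [MeasurableSpace Ω] [MeasurableSpace α]
    {μ : Measure Ω} [SFinite μ] {n : ℕ} {ρ : Measure (Fin n ⊕ Fin n → α)} [SFinite ρ]
    {c : Ω → α → α → ℝ≥0∞} (hc : Measurable fun p : Ω × α × α => c p.1 p.2.1 p.2.2) :
    ∫⁻ ω, ∫⁻ z, matchingCost (c ω) (fun k => z (.inl k)) (fun k => z (.inr k)) ∂ρ ∂μ ≤
      ∫⁻ z, matchingCost (fun a b => ∫⁻ ω, c ω a b ∂μ) (fun k => z (.inl k)) (fun k => z (.inr k))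
        ∂ρ := by
  have hF : Measurable fun p : Ω × (Fin n ⊕ Fin n → α) =>
      matchingCost (c p.1) (fun k => p.2 (.inl k)) (fun k => p.2 (.inr k)) :=
    measurable_matchingCost (c := fun p : Ω × (Fin n ⊕ Fin n → α) => c p.1)
      (x := fun i p => p.2 (.inl i)) (y := fun i p => p.2 (.inr i))
      (hc.comp ((measurable_fst.comp measurable_fst).prodMk measurable_snd))
      (fun i => (measurable_pi_apply (Sum.inl i)).comp measurable_snd)
      (fun i => (measurable_pi_apply (Sum.inr i)).comp measurable_snd)
  rw [lintegral_lintegral_swap hF.aemeasurable]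
  exact lintegral_mono fun z => lintegral_matchingCost_le_matchingCost_lintegral
    (fun a b => hc.comp (measurable_prodMk_right (y := (a, b)))) _ _

/-- The cost of the points of the spherical square with corner `q`. -/
noncomputable def squareCost (N n : ℕ) (q : EuclideanSpace ℝ (Fin 2)) :
    EuclideanSpace ℝ (Fin 3) → EuclideanSpace ℝ (Fin 3) → ℝ≥0∞ :=
  crossingCost (sphericalSquare N n q)
    (fun p p' => edist (lambert (sphereRadius N) p) (lambert (sphereRadius N) p'))
    (ENNReal.ofReal (√2 * √n))

theorem measurable_squareCost (N n : ℕ) :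
    Measurable fun p : EuclideanSpace ℝ (Fin 2) × EuclideanSpace ℝ (Fin 3) ×
      EuclideanSpace ℝ (Fin 3) => squareCost N n p.1 p.2.1 p.2.2 := by
  have hlm := measurable_lambert (sphereRadius N)
  have h1 : Measurable fun p : EuclideanSpace ℝ (Fin 2) × EuclideanSpace ℝ (Fin 3) ×
    EuclideanSpace ℝ (Fin 3) => lambert (sphereRadius N) p.2.1 :=
      hlm.comp (measurable_fst.comp measurable_snd)
  have h2 : Measurable fun p : EuclideanSpace ℝ (Fin 2) × EuclideanSpace ℝ (Fin 3) ×
    EuclideanSpace ℝ (Fin 3) => lambert (sphereRadius N) p.2.2 :=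
      hlm.comp (measurable_snd.comp measurable_snd)
  exact Measurable.ite ((h1.sub measurable_fst) (measurableSet_squareOfArea n))
    (Measurable.ite ((h2.sub measurable_fst) (measurableSet_squareOfArea n))
      (h1.edist h2) measurable_const) measurable_const

/-- The left side of `lintegral_uniformSquare_le` does not depend on the corner, so integrating over
the corners multiplies it by their area. -/
theorem volume_cornerSet_mul_le {n N : ℕ} (hn : 0 < n) (hnN : n < N) :
    volume (cornerSet N n) *
      ∫⁻ a, matchingCost edist (fun k => a (.inl k)) (fun k => a (.inr k))
        ∂(Measure.pi fun _ : Fin n ⊕ Fin n => uniformSquare n) ≤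
      15 * n * (∫⁻ z, matchingCost edist (fun k => z (.inl k)) (fun k => z (.inr k))
        ∂(Measure.pi fun _ : Fin N ⊕ Fin N => uniformSphere N)) +
      volume (cornerSet N n) * (ENNReal.ofReal (√2 * √n) * (2 * ENNReal.ofReal √n)) := by
  have hN0 : 0 < N := hn.trans hnN
  have := isProbabilityMeasure_uniformSphere hN0
  have hle : ∫⁻ z, matchingCost (fun a b => ∫⁻ q in cornerSet N n, squareCost N n q a b)
      (fun k => z (.inl k)) (fun k => z (.inr k))
        ∂(Measure.pi fun _ : Fin N ⊕ Fin N => uniformSphere N) ≤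
      15 * n * (∫⁻ z, matchingCost edist (fun k => z (.inl k)) (fun k => z (.inr k))
        ∂(Measure.pi fun _ : Fin N ⊕ Fin N => uniformSphere N)) := by
    rw [← lintegral_const_mul _ (measurable_matchingCost_sum measurable_edist N)]
    refine lintegral_mono_ae ?_
    filter_upwards [ae_pi_forall_mem (ae_uniformSphere_norm N)] with z hz
    rw [← matchingCost_const_mul (by finiteness)]
    exact matchingCost_mono fun i j => lintegral_crossingCost_le hN0 (hz _) (hz _)
  calc volume (cornerSet N n) *
      ∫⁻ a, matchingCost edist (fun k => a (.inl k)) (fun k => a (.inr k))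
        ∂(Measure.pi fun _ : Fin n ⊕ Fin n => uniformSquare n)
      = ∫⁻ _ in cornerSet N n, ∫⁻ a, matchingCost edist (fun k => a (.inl k)) (fun k => a (.inr k))
        ∂(Measure.pi fun _ : Fin n ⊕ Fin n => uniformSquare n) := by
        rw [setLIntegral_const, mul_comm]
    _ ≤ ∫⁻ q in cornerSet N n, (∫⁻ z, matchingCost (squareCost N n q) (fun k => z (.inl k))
          (fun k => z (.inr k)) ∂(Measure.pi fun _ : Fin N ⊕ Fin N => uniformSphere N) +
          ENNReal.ofReal (√2 * √n) * (2 * ENNReal.ofReal √n)) :=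
        setLIntegral_mono' (measurableSet_cornerSet N n)
          fun q hq => lintegral_uniformSquare_le hn hnN hq
    _ ≤ _ := by
        rw [lintegral_add_right _ measurable_const, setLIntegral_const,
          mul_comm (volume (cornerSet N n))]
        exact add_le_add_left
          ((lintegral_lintegral_matchingCost_le (measurable_squareCost N n)).trans hle) _

theorem lintegral_matchingCost_uniformSquare_le_mul {n : ℕ} (hn : 0 < n) :
    ∫⁻ a, matchingCost edist (fun k => a (.inl k)) (fun k => a (.inr k))
        ∂(Measure.pi fun _ : Fin n ⊕ Fin n => uniformSquare n) ≤
      n * ENNReal.ofReal (√2 * √n) := by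
  have := isProbabilityMeasure_uniformSquare hn
  refine lintegral_matchingCost_le_mul (ν := uniformSquare n) (S := squareOfArea n)
    (ae_cond_mem (measurableSet_squareOfArea n)) (fun x hx y hy => ?_) n
  rw [edist_dist]
  exact ENNReal.ofReal_le_ofReal (dist_le_of_mem_squareOfArea hx hy)

theorem lintegral_matchingCost_uniformSphere_ne_top {N : ℕ} (hN : 0 < N) :
    ∫⁻ z, matchingCost edist (fun k => z (.inl k)) (fun k => z (.inr k))
        ∂(Measure.pi fun _ : Fin N ⊕ Fin N => uniformSphere N) ≠ ∞ := by
  have := isProbabilityMeasure_uniformSphere hN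
  refine ne_top_of_le_ne_top ?_ (lintegral_matchingCost_le_mul (ae_uniformSphere_norm N)
    (L := ENNReal.ofReal (sphereRadius N + sphereRadius N)) (fun x hx y hy => ?_) N)
  · finiteness
  · rw [edist_dist]
    refine ENNReal.ofReal_le_ofReal ((dist_le_norm_add_norm x y).trans ?_)
    rw [hx, hy]

/-! ### Constants and conclusion -/

/-- The comparison of the square and the sphere when the sphere is so large that squares of area `n`
fit well into the domain of Lambert's projection. -/
theorem toReal_lintegral_uniformSquare_le {n N : ℕ} (hn : 51 ≤ n) (hN : N = n ^ 2) :
    (∫⁻ a, matchingCost edist (fun k => a (.inl k)) (fun k => a (.inr k))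
        ∂(Measure.pi fun _ : Fin n ⊕ Fin n => uniformSquare n)).toReal ≤
      4 * n + 1000 * n / N * (∫⁻ z, matchingCost edist (fun k => z (.inl k)) (fun k => z (.inr k))
        ∂(Measure.pi fun _ : Fin N ⊕ Fin N => uniformSphere N)).toReal := by
  have hn0 : 0 < n := by omega
  have hnN : n < N := by rw [hN]; nlinarith
  have hnR : (51 : ℝ) ≤ n := by exact_mod_cast hn
  have hNR : (N : ℝ) = (n : ℝ) ^ 2 := by rw [hN]; push_cast; rfl
  have hM := lintegral_matchingCost_uniformSphere_ne_top (hn0.trans hnN)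
  have hvol := volume_cornerSet N n
  have hr := sphereRadius_pos (hn0.trans hnN)
  have hr2 : sphereRadius N ^ 2 = n ^ 2 / (4 * Real.pi) := by
    rw [sphereRadius, Real.sq_sqrt (by positivity), hNR]
  have hpi := Real.pi_pos
  have hpi' : Real.pi < 3.15 := Real.pi_lt_d2
  -- This amounts to `16π ≤ n`, which is where `51` comes from.
  have hsq : √n ≤ sphereRadius N / 2 := by
    rw [Real.sqrt_le_left (by positivity), div_pow, hr2, div_div, le_div_iff₀ (by positivity)]
    nlinarith
  have hsn : √n * √n = n := Real.mul_self_sqrt (by positivity)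
  have h2 : √2 ≤ 2 := by
    rw [Real.sqrt_le_left (by norm_num)]
    norm_num
  have key := volume_cornerSet_mul_le hn0 hnN
  set M := ∫⁻ z, matchingCost edist (fun k => z (.inl k)) (fun k => z (.inr k))
        ∂(Measure.pi fun _ : Fin N ⊕ Fin N => uniformSphere N)
  set m := ∫⁻ a, matchingCost edist (fun k => a (.inl k)) (fun k => a (.inr k))
        ∂(Measure.pi fun _ : Fin n ⊕ Fin n => uniformSquare n)
  have key' := ENNReal.toReal_mono (by rw [hvol]; finiteness) key
  rw [ENNReal.toReal_add (by finiteness) (by rw [hvol]; finiteness), hvol] at key'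
  simp only [ENNReal.toReal_mul, ENNReal.toReal_pow, ENNReal.toReal_natCast,
    ENNReal.toReal_ofNat] at key'
  rw [ENNReal.toReal_ofReal (by linarith), ENNReal.toReal_ofReal (by positivity),
    ENNReal.toReal_ofReal (by positivity)] at key'
  set V := (sphereRadius N - √n) ^ 2 with hV
  have hVge : (n : ℝ) ^ 2 / (16 * Real.pi) ≤ V := by
    have : (sphereRadius N / 2) ^ 2 ≤ V := by
      rw [hV]
      exact pow_le_pow_left₀ (by positivity) (by linarith) 2
    rw [div_pow, hr2, div_div] at this
    refine le_trans (le_of_eq ?_) this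
    congr 1
    ring
  have hVpos : 0 < V := lt_of_lt_of_le (by positivity) hVge
  have hMnn : 0 ≤ M.toReal := ENNReal.toReal_nonneg
  have h1 : √2 * √n * (2 * √n) ≤ 4 * n := by
    calc √2 * √n * (2 * √n) = 2 * √2 * (√n * √n) := by ring
      _ ≤ 2 * 2 * n := by rw [hsn]; gcongr
      _ = 4 * n := by ring
  -- The constant: `15 * 16π < 756 ≤ 1000`.
  have h3 : 15 * n ≤ V * (1000 * n / N) := by
    calc (15 * n : ℝ) ≤ n ^ 2 / (16 * Real.pi) * (1000 * n / N) := by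
          rw [hNR, div_mul_div_comm, le_div_iff₀ (by positivity)]
          have : (0 : ℝ) < n ^ 3 := by positivity
          nlinarith
      _ ≤ V * (1000 * n / N) := by gcongr
  refine le_of_mul_le_mul_left ?_ hVpos
  calc V * m.toReal ≤ 15 * n * M.toReal + V * (√2 * √n * (2 * √n)) := key'
    _ ≤ V * (1000 * n / N) * M.toReal + V * (4 * n) := by gcongr
    _ = _ := by ring

theorem proposition1p7 :
    ∃ C : ℝ, 0 < C ∧ ∀ n N : ℕ, 2 ≤ n → N = n ^ 2 →
      ∀ {Ω Ω' : Type*} [MeasurableSpace Ω] [MeasurableSpace Ω']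
        (P : Measure Ω) [IsProbabilityMeasure P] (P' : Measure Ω') [IsProbabilityMeasure P']
        (X Y : Fin N → Ω → EuclideanSpace ℝ (Fin 3))
        (A B : Fin n → Ω' → EuclideanSpace ℝ (Fin 2)),
        IsIIDPair X Y (uniformSphere N) P →
        IsIIDPair A B (uniformSquare n) P' →
        1 / (n : ℝ) * ∫ ω, minMatchingCost (fun i => A i ω) (fun i => B i ω) ∂P' ≤
          C + C / (N : ℝ) * ∫ ω, minMatchingCost (fun i => X i ω) (fun i => Y i ω) ∂P := by
  refine ⟨1000, by norm_num, fun n N hn hN Ω Ω' _ _ P _ P' _ X Y A B hXY hAB => ?_⟩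
  rw [integral_minMatchingCost hXY, integral_minMatchingCost hAB]
  have hn0 : 0 < n := by omega
  have hnR : (0 : ℝ) < n := by exact_mod_cast hn0
  rcases le_or_gt 51 n with h | h
  · have := toReal_lintegral_uniformSquare_le h hN
    set M := (∫⁻ z, matchingCost edist (fun k => z (.inl k)) (fun k => z (.inr k))
        ∂(Measure.pi fun _ : Fin N ⊕ Fin N => uniformSphere N)).toReal
    rw [one_div, inv_mul_le_iff₀ hnR]
    refine this.trans ?_
    calc 4 * n + 1000 * n / N * M ≤ 1000 * n + 1000 * n / N * M := by gcongr; norm_num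
      _ = n * (1000 + 1000 / N * M) := by ring
  -- For `n ≤ 50` the square has diameter at most `10`, so the additive constant alone is enough.
  · have h1 := ENNReal.toReal_mono (by finiteness)
      (lintegral_matchingCost_uniformSquare_le_mul hn0)
    rw [ENNReal.toReal_mul, ENNReal.toReal_natCast, ENNReal.toReal_ofReal (by positivity)] at h1
    have h2 : √2 * √n ≤ 1000 := by
      rw [← Real.sqrt_mul (by norm_num), Real.sqrt_le_left (by norm_num)]
      have : (n : ℝ) < 51 := by exact_mod_cast h
      linarith
    refine le_add_of_le_of_nonneg ?_ (by positivity)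
    rw [one_div, inv_mul_le_iff₀ hnR]
    exact h1.trans (by gcongr)
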